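/- Let $S$ be a (nonempty) inverse semigroup, with $s^*$ the inverse of $s$, $E(S)$ its set of idempotents, and natural order $s\le t\iff s=ts^*s$. Let $R$ be an indecomposable commutative unital ring (its only idempotents are $0$ and $1$), let $X$ be a locally compact Hausdorff zero-dimensional space, and let $A_R(X)$ be the $R$-algebra of locally constant functions $f\colon X\to R$ with compact support $\operatorname{supp} f=\{x: f(x)\neq 0\}$, under pointwise operations. Let $\alpha=(\{D_s\}_{s\in S},\{\alpha_s\}_{s\in S})$ be an algebraic partial action of $S$ on $A_R(X)$: each $D_s$ is an ideal, each $\alpha_s\colon D_{s^*}\to D_s$ is an isomorphism of $R$-algebras, $s\mapsto\alpha_s$ is a partial homomorphism into the inverse semigroup of partial bijections (that is, $\alpha_{s^*}=\alpha_s^{-1}$; $\alpha_s\circ\alpha_t\le\alpha_{st}$; and $\alpha_s\le\alpha_t$ whenever $s\le t$, where $\le$ between partial bijections means restriction), and $A_R(X)$ is the $R$-span of $\bigcup_{e\in E(S)}D_e$. Suppose that each $D_s$ has local units: for every finite $F\subseteq D_s$ there is an idempotent $e\in D_s$ with $er=r=re$ for all $r\in F$. Then there is a topological partial action $\theta=(\{X_s\}_{s\in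 S},\{\theta_s\}_{s\in S})$ of $S$ on $X$ (each $X_s\subseteq X$ is open, each $\theta_s\colon X_{s^*}\to X_s$ is a homeomorphism, $s\mapsto\theta_s$ is a partial homomorphism, and $X=\bigcup_{e\in E(S)}X_e$) such that: 1. $\alpha$ is the dual partial action of $\theta$: for all $s\in S$, $D_s=\{f\in A_R(X):\operatorname{supp} f\subseteq X_s\}$, and for $f\in D_{s^*}$, $\alpha_s(f)$ equals $f\circ\theta_{s^*}$ on $X_s$ and $0$ on $X\setminus X_s$; 2. there is an isomorphism of $R$-algebras $A_R(X)\rtimes_\alpha S\cong A_R(S\ltimes_\theta X)$. Here the crossed product $A_R(X)\rtimes_\alpha S$ is the quotient of the $R$-module of finite formal sums $\sum_s a_s\delta_s$ ($a_s\in D_s$), with the bilinear product determined by $(a\delta_s)(b\delta_t)=\alpha_s(\alpha_{s^*}(a)b)\delta_{st}$, by the ideal that is additively generated by the elements $a\delta_r-a\delta_s$ with $r\le s$ and $a\in D_r$. The groupoid of germs $S\ltimes_\theta X$ consists of the classes $[s,x]$ of pairs $(s,x)$ with $x\in X_{s^*}$, where $(s,x)\sim(t,y)$ iff $x=y$ and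 there is $u\le s,t$ with $x\in X_{u^*}$; its source and range are $[s,x]\mapsto x$ and $[s,x]\mapsto\theta_s(x)$, its product is $[s,\theta_t(y)][t,y]=[st,y]$, its inverse is $[s,x]^{-1}=[s^*,\theta_s(x)]$, and its topology has as basis the sets $\{[s,x]:x\in U\}$ with $s\in S$ and $U\subseteq X_{s^*}$ open. It is an ample groupoid $\mathcal G$ (not necessarily Hausdorff), and its Steinberg algebra $A_R(\mathcal G)$ is the $R$-span in $R^{\mathcal G}$ of the characteristic functions of compact-open bisections (compact-open sets on which source and range are injective), with the convolution product $(f*g)(a)=\sum_{xy=a}f(x)g(y)$. -/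

import Mathlib

open Topology TopologicalSpace

/-! ### Inverse semigroups -/

/-- An inverse semigroup: every `s` has exactly one `s⁻¹` (written `s*` in the literature) with
`s s⁻¹ s = s` and `s⁻¹ s s⁻¹ = s⁻¹`. -/
class InverseSemigroup (S : Type*) extends Semigroup S, Inv S where
  mul_inv_mul : ∀ s : S, s * s⁻¹ * s = s
  inv_mul_inv : ∀ s : S, s⁻¹ * s * s⁻¹ = s⁻¹
  inv_unique : ∀ s t : S, s * t * s = s → t * s * t = t → t = s⁻¹

namespace InverseSemigroup

variable {S : Type*} [InverseSemigroup S]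

/-- The natural partial order: `s ≤ t` iff `s = t s* s`. -/
def NatLE (s t : S) : Prop := s = t * s⁻¹ * s

infix:50 " ≼ " => NatLE

theorem inv_inv' (s : S) : s⁻¹⁻¹ = s :=
  (inv_unique s⁻¹ s (inv_mul_inv s) (mul_inv_mul s)).symm

theorem inv_idem {e : S} (he : e * e = e) : e⁻¹ = e :=
  (inv_unique e e (by rw [he, he]) (by rw [he, he])).symm

theorem idem_mul_idem {e f : S} (he : e * e = e) (hf : f * f = f) : e * f * (e * f) = e * f := by
  have h1 := mul_inv_mul (e * f)
  have h2 := inv_mul_inv (e * f)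
  set x := (e * f)⁻¹ with hx
  have h3 : f * x * e = x := by
    refine inv_unique (e * f) _ ?_ ?_
    · calc e * f * (f * x * e) * (e * f) = e * (f * f) * x * (e * e) * f := by
            simp only [mul_assoc]
        _ = e * f * x * (e * f) := by rw [he, hf]; simp only [mul_assoc]
        _ = _ := h1
    · calc f * x * e * (e * f) * (f * x * e) = f * (x * (e * e) * (f * f) * x) * e := by
            simp only [mul_assoc]
        _ = f * (x * (e * f) * x) * e := by rw [he, hf]; simp only [mul_assoc]
        _ = _ := by rw [h2]
  have h4 : x * x = x := by
    calc x * x = (f * x * e) * (f * x * e) := by rw [h3]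
      _ = f * (x * (e * f) * x) * e := by simp only [mul_assoc]
      _ = x := by rw [h2, h3]
  have h5 : e * f = x := by
    rw [← inv_inv' (e * f), ← hx, inv_idem h4]
  rw [h5, h4]

theorem idem_comm {e f : S} (he : e * e = e) (hf : f * f = f) : e * f = f * e := by
  have h1 := idem_mul_idem he hf
  have h2 := idem_mul_idem hf he
  have h3 : f * e = (e * f)⁻¹ := by
    refine inv_unique _ _ ?_ ?_
    · calc e * f * (f * e) * (e * f) = e * (f * f) * (e * e) * f := by simp only [mul_assoc]
        _ = e * f * (e * f) := by rw [he, hf]; simp only [mul_assoc]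
        _ = _ := h1
    · calc f * e * (e * f) * (f * e) = f * (e * e) * (f * f) * e := by simp only [mul_assoc]
        _ = f * e * (f * e) := by rw [he, hf]; simp only [mul_assoc]
        _ = _ := h2
  rw [h3, inv_idem h1]

theorem inv_mul_idem (s : S) : s⁻¹ * s * (s⁻¹ * s) = s⁻¹ * s := by
  rw [← mul_assoc, inv_mul_inv]

theorem mul_inv_idem (s : S) : s * s⁻¹ * (s * s⁻¹) = s * s⁻¹ := by
  rw [← mul_assoc, mul_inv_mul]

theorem mul_inv_rev' (s t : S) : (s * t)⁻¹ = t⁻¹ * s⁻¹ := by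
  have hc := idem_comm (inv_mul_idem s) (mul_inv_idem t)
  refine (inv_unique _ _ ?_ ?_).symm
  · calc s * t * (t⁻¹ * s⁻¹) * (s * t) = s * ((t * t⁻¹) * (s⁻¹ * s)) * t := by
          simp only [mul_assoc]
      _ = (s * s⁻¹ * s) * (t * t⁻¹ * t) := by rw [← hc]; simp only [mul_assoc]
      _ = s * t := by rw [mul_inv_mul, mul_inv_mul]
  · calc t⁻¹ * s⁻¹ * (s * t) * (t⁻¹ * s⁻¹) = t⁻¹ * ((s⁻¹ * s) * (t * t⁻¹)) * s⁻¹ := by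
          simp only [mul_assoc]
      _ = (t⁻¹ * t * t⁻¹) * (s⁻¹ * s * s⁻¹) := by rw [hc]; simp only [mul_assoc]
      _ = t⁻¹ * s⁻¹ := by rw [inv_mul_inv, inv_mul_inv]

theorem natLE_refl (s : S) : s ≼ s := (mul_inv_mul s).symm

/-- `t e ≤ t` for every idempotent `e`. -/
theorem mul_idem_natLE (t : S) {e : S} (he : e * e = e) : t * e ≼ t := by
  have hc := idem_comm he (inv_mul_idem t)
  unfold NatLE
  rw [mul_inv_rev', inv_idem he]
  calc t * e = t * t⁻¹ * t * (e * e) := by rw [mul_inv_mul, he]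
    _ = t * ((t⁻¹ * t) * e) * e := by simp only [mul_assoc]
    _ = t * (e * (t⁻¹ * t)) * e := by rw [hc]
    _ = t * (e * t⁻¹) * (t * e) := by simp only [mul_assoc]

/-- `e t ≤ t` for every idempotent `e`. -/
theorem idem_mul_natLE (t : S) {e : S} (he : e * e = e) : e * t ≼ t := by
  have hc := idem_comm he (mul_inv_idem t)
  unfold NatLE
  rw [mul_inv_rev', inv_idem he]
  calc e * t = e * e * (t * t⁻¹ * t) := by rw [mul_inv_mul, he]
    _ = e * (e * (t * t⁻¹)) * t := by simp only [mul_assoc]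
    _ = (t * t⁻¹) * (e * e) * t := by rw [hc, ← mul_assoc e, hc, mul_assoc (t * t⁻¹)]
    _ = t * (t⁻¹ * e) * (e * t) := by simp only [mul_assoc]

theorem natLE_iff_mul_idem {s t : S} : s ≼ t ↔ ∃ e : S, e * e = e ∧ s = t * e := by
  constructor
  · intro h
    refine ⟨s⁻¹ * s, inv_mul_idem s, ?_⟩
    rw [← mul_assoc]; exact h
  · rintro ⟨e, he, rfl⟩
    exact mul_idem_natLE t he

theorem natLE_iff_idem_mul {s t : S} : s ≼ t ↔ ∃ e : S, e * e = e ∧ s = e * t := by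
  constructor
  · intro h
    obtain ⟨e, he, rfl⟩ := natLE_iff_mul_idem.1 h
    have hc := idem_comm he (inv_mul_idem t)
    refine ⟨t * e * t⁻¹, ?_, ?_⟩
    · calc t * e * t⁻¹ * (t * e * t⁻¹) = t * (e * (t⁻¹ * t)) * e * t⁻¹ := by
            simp only [mul_assoc]
        _ = (t * t⁻¹ * t) * (e * e) * t⁻¹ := by rw [hc]; simp only [mul_assoc]
        _ = t * e * t⁻¹ := by rw [mul_inv_mul, he]
    · calc t * e = t * t⁻¹ * t * e := by rw [mul_inv_mul]
        _ = t * ((t⁻¹ * t) * e) := by simp only [mul_assoc]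
        _ = t * e * t⁻¹ * t := by rw [← hc]; simp only [mul_assoc]
  · rintro ⟨e, he, rfl⟩
    exact idem_mul_natLE t he

theorem natLE_trans {s t u : S} (h : s ≼ t) (h' : t ≼ u) : s ≼ u := by
  obtain ⟨e, he, rfl⟩ := natLE_iff_mul_idem.1 h
  obtain ⟨f, hf, rfl⟩ := natLE_iff_mul_idem.1 h'
  exact natLE_iff_mul_idem.2 ⟨f * e, idem_mul_idem hf he, by rw [mul_assoc]⟩

theorem natLE_mul_left (u : S) {s t : S} (h : s ≼ t) : u * s ≼ u * t := by
  obtain ⟨e, he, rfl⟩ := natLE_iff_mul_idem.1 h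
  exact natLE_iff_mul_idem.2 ⟨e, he, by rw [mul_assoc]⟩

theorem natLE_mul_right (u : S) {s t : S} (h : s ≼ t) : s * u ≼ t * u := by
  obtain ⟨e, he, rfl⟩ := natLE_iff_idem_mul.1 h
  exact natLE_iff_idem_mul.2 ⟨e, he, by rw [mul_assoc]⟩

theorem natLE_inv {s t : S} (h : s ≼ t) : s⁻¹ ≼ t⁻¹ := by
  obtain ⟨e, he, rfl⟩ := natLE_iff_mul_idem.1 h
  exact natLE_iff_idem_mul.2 ⟨e, he, by rw [mul_inv_rev', inv_idem he]⟩

end InverseSemigroup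

open InverseSemigroup

/-! ### Partial actions -/

/-- A family of bijections `θ s : D s⁻¹ → D s` between subsets of `Y`, seen as elements of the
inverse semigroup of partial bijections of `Y` (ordered by restriction), is a partial homomorphism:
`θ (s⁻¹) = (θ s)⁻¹`, `θ s ∘ θ t ≤ θ (s t)`, and `θ s ≤ θ t` whenever `s ≤ t`. -/
structure IsPartialHom {S Y : Type*} [InverseSemigroup S] (D : S → Set Y)
    (θ : ∀ s, D s⁻¹ ≃ D s) : Prop where
  inv : ∀ (s : S) (x : D s⁻¹), ∃ h : (θ s x : Y) ∈ D s⁻¹⁻¹,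
    (θ s⁻¹ ⟨θ s x, h⟩ : Y) = x
  mul : ∀ (s t : S) (x : D t⁻¹) (hx : (θ t x : Y) ∈ D s⁻¹),
    ∃ h : (x : Y) ∈ D (s * t)⁻¹, (θ (s * t) ⟨x, h⟩ : Y) = θ s ⟨θ t x, hx⟩
  mono : ∀ s t : S, s ≼ t → ∀ x : D s⁻¹,
    ∃ h : (x : Y) ∈ D t⁻¹, (θ t ⟨x, h⟩ : Y) = θ s x

namespace IsPartialHom

variable {S Y : Type*} [InverseSemigroup S] {D : S → Set Y} {θ : ∀ s, D s⁻¹ ≃ D s}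

theorem subset_of_natLE (H : IsPartialHom D θ) {s t : S} (h : s ≼ t) : D s ⊆ D t := by
  intro x hx
  have hx' : x ∈ D s⁻¹⁻¹ := by rwa [inv_inv']
  obtain ⟨h', -⟩ := H.mono _ _ (natLE_inv h) ⟨x, hx'⟩
  rwa [inv_inv'] at h'

/-- The image of `θ s ∘ θ t` lies in `D (s t)`. -/
theorem image_mem (H : IsPartialHom D θ) (s t : S) (y : D s⁻¹) (hy : (y : Y) ∈ D t) :
    (θ s y : Y) ∈ D (s * t) := by
  have hx : (θ t ((θ t).symm ⟨y, hy⟩) : Y) ∈ D s⁻¹ := by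
    rw [Equiv.apply_symm_apply]; exact y.2
  obtain ⟨h, e⟩ := H.mul s t ((θ t).symm ⟨y, hy⟩) hx
  have e2 : (⟨_, hx⟩ : D s⁻¹) = y := by
    apply Subtype.ext
    simp
  rw [e2] at e
  rw [← e]
  exact (θ (s * t) _).2

/-- `D s⁻¹ ⊆ D (s⁻¹ s)`. -/
theorem mem_source_idem (H : IsPartialHom D θ) (s : S) (x : D s⁻¹) : (x : Y) ∈ D (s⁻¹ * s) := by
  obtain ⟨h, e⟩ := H.inv s x
  have := H.image_mem s⁻¹ s ⟨_, h⟩ (θ s x).2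
  rwa [e] at this

/-- Idempotents act as identities. -/
theorem idem_apply (H : IsPartialHom D θ) {e : S} (he : e * e = e) (x : D e⁻¹) :
    (θ e x : Y) = x := by
  have h0 : e⁻¹ = e := inv_idem he
  have hD : D e = D e⁻¹ := by rw [h0]
  have hx : (θ e x : Y) ∈ D e⁻¹ := hD.subset (θ e x).2
  obtain ⟨h1, h2⟩ := H.mul e e x hx
  have key : ∀ u : S, u = e → ∀ (h : (x : Y) ∈ D u⁻¹), (θ u ⟨x, h⟩ : Y) = θ e x := by
    rintro u rfl h; rfl
  rw [key _ he] at h2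
  have h3 := (θ e).injective (Subtype.ext h2)
  exact (congrArg Subtype.val h3).symm

end IsPartialHom

/-- A topological partial action of `S` on `X`. -/
structure TopPartialAction (S X : Type*) [InverseSemigroup S] [TopologicalSpace X] where
  /-- The open sets `X_s`. -/
  dom : S → Set X
  isOpen_dom : ∀ s, IsOpen (dom s)
  /-- The homeomorphisms `θ_s : X_{s*} → X_s`. -/
  map : ∀ s, dom s⁻¹ ≃ₜ dom s
  isPartialHom : IsPartialHom dom fun s => (map s).toEquiv
  nondegenerate : ⋃ e ∈ {e : S | e * e = e}, dom e = Set.univ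

/-- An algebraic partial action of `S` on the associative (not necessarily unital) `R`-algebra
`A`. -/
structure AlgPartialAction (S R A : Type*) [InverseSemigroup S] [CommRing R] [NonUnitalRing A]
    [Module R A] [IsScalarTower R A A] [SMulCommClass R A A] where
  /-- The two-sided ideals `A_s`. -/
  ideal : S → Submodule R A
  mul_mem_left : ∀ (s : S) (a : A) {b : A}, b ∈ ideal s → a * b ∈ ideal s
  mul_mem_right : ∀ (s : S) {a : A} (b : A), a ∈ ideal s → a * b ∈ ideal s
  /-- The `R`-algebra isomorphisms `α_s : A_{s*} → A_s`. -/
  map : ∀ s, ideal s⁻¹ ≃ₗ[R] ideal s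
  map_mul : ∀ (s : S) (a b : ideal s⁻¹),
    (map s ⟨a * b, mul_mem_left _ _ b.2⟩ : A) = map s a * map s b
  isPartialHom : IsPartialHom (fun s => (ideal s : Set A)) fun s => (map s).toEquiv
  nondegenerate : Submodule.span R (⋃ e ∈ {e : S | e * e = e}, (ideal e : Set A)) = ⊤

/-! ### Crossed products -/

namespace AlgPartialAction

variable {S R A : Type*} [InverseSemigroup S] [CommRing R] [NonUnitalRing A]
  [Module R A] [IsScalarTower R A A] [SMulCommClass R A A] (α : AlgPartialAction S R A)

open DirectSum

/-- The `R`-module `𝓛(α)` of finite formal sums `∑ a_s δ_s` with `a_s ∈ A_s`. -/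
abbrev FormalSum : Type _ := ⨁ s, α.ideal s

/-- The formal monomial `a δ_s`. -/
noncomputable def delta (s : S) : α.ideal s →ₗ[R] α.FormalSum :=
  letI := Classical.decEq S
  DirectSum.lof R S (fun s => α.ideal s) s

theorem inv_ideal_eq (s : S) : α.ideal s⁻¹⁻¹ = α.ideal s := by rw [inv_inv']

/-- The coefficient `α_s (α_{s*} (a) b)` of the product `(a δ_s) (b δ_t) = α_s (α_{s*} (a) b) δ_{st}`,
as an element of `A`. -/
def coeff (s t : S) (a : α.ideal s) (b : α.ideal t) : A :=
  α.map s ⟨α.map s⁻¹ ⟨a, by rw [inv_ideal_eq]; exact a.2⟩ * b,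
    α.mul_mem_right _ _ (α.map s⁻¹ _).2⟩

theorem coeff_mem (s t : S) (a : α.ideal s) (b : α.ideal t) : α.coeff s t a b ∈ α.ideal (s * t) :=
  α.isPartialHom.image_mem s t ⟨_, _⟩ (α.mul_mem_left _ _ b.2)

/-- `(a, b) ↦ α_s (α_{s*} (a) b)` as a bilinear map `A_s × A_t → A_{st}`. -/
def coeffHom (s t : S) : α.ideal s →ₗ[R] α.ideal t →ₗ[R] α.ideal (s * t) :=
  have hm : ∀ {a : A}, a ∈ α.ideal s → a ∈ α.ideal s⁻¹⁻¹ := fun h => by rwa [inv_ideal_eq]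
  LinearMap.mk₂ R (fun a b => ⟨α.coeff s t a b, α.coeff_mem s t a b⟩)
    (fun a a' b => Subtype.ext <|
      (congrArg (fun z => (α.map s z : A)) (Subtype.ext <|
        (congrArg (fun z : α.ideal s⁻¹ => (z : A) * b)
          (map_add (α.map s⁻¹) ⟨a, hm a.2⟩ ⟨a', hm a'.2⟩)).trans (add_mul _ _ _))).trans
      (congrArg Subtype.val (map_add (α.map s)
        ⟨α.map s⁻¹ ⟨a, hm a.2⟩ * b, α.mul_mem_right _ _ (α.map s⁻¹ _).2⟩
        ⟨α.map s⁻¹ ⟨a', hm a'.2⟩ * b, α.mul_mem_right _ _ (α.map s⁻¹ _).2⟩)))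
    (fun c a b => Subtype.ext <|
      (congrArg (fun z => (α.map s z : A)) (Subtype.ext <|
        (congrArg (fun z : α.ideal s⁻¹ => (z : A) * b)
          (map_smul (α.map s⁻¹) c ⟨a, hm a.2⟩)).trans (smul_mul_assoc _ _ _))).trans
      (congrArg Subtype.val (map_smul (α.map s) c
        ⟨α.map s⁻¹ ⟨a, hm a.2⟩ * b, α.mul_mem_right _ _ (α.map s⁻¹ _).2⟩)))
    (fun a b b' => Subtype.ext <|
      (congrArg (fun z => (α.map s z : A)) (Subtype.ext <| mul_add _ _ _)).trans
      (congrArg Subtype.val (map_add (α.map s)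
        ⟨α.map s⁻¹ ⟨a, hm a.2⟩ * b, α.mul_mem_right _ _ (α.map s⁻¹ _).2⟩
        ⟨α.map s⁻¹ ⟨a, hm a.2⟩ * b', α.mul_mem_right _ _ (α.map s⁻¹ _).2⟩)))
    (fun c a b => Subtype.ext <|
      (congrArg (fun z => (α.map s z : A)) (Subtype.ext <| mul_smul_comm _ _ _)).trans
      (congrArg Subtype.val (map_smul (α.map s) c
        ⟨α.map s⁻¹ ⟨a, hm a.2⟩ * b, α.mul_mem_right _ _ (α.map s⁻¹ _).2⟩)))

/-- The (possibly non-associative) multiplication of `𝓛(α)`: the bilinear extension of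
`(a δ_s) (b δ_t) = α_s (α_{s*} (a) b) δ_{st}`. -/
noncomputable def formalMul : α.FormalSum →ₗ[R] α.FormalSum →ₗ[R] α.FormalSum :=
  letI := Classical.decEq S
  DirectSum.toModule R S _ fun s =>
    (DirectSum.toModule R S _ fun t => ((α.coeffHom s t).compr₂ (α.delta (s * t))).flip).flip

theorem formalMul_delta (s t : S) (a : α.ideal s) (b : α.ideal t) :
    α.formalMul (α.delta s a) (α.delta t b) =
      α.delta (s * t) ⟨α.coeff s t a b, α.coeff_mem s t a b⟩ := by
  classical
  simp only [formalMul, delta]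
  erw [DirectSum.toModule_lof]
  rw [LinearMap.flip_apply]
  erw [DirectSum.toModule_lof]
  rfl

theorem ideal_mono {r s : S} (h : r ≼ s) : α.ideal r ≤ α.ideal s :=
  α.isPartialHom.subset_of_natLE h

/-- The additive subgroup `𝓝(α)` of `𝓛(α)` generated by the `a δ_r - a δ_s` with `r ≤ s` and
`a ∈ A_r`. -/
def nullAddSubgroup : AddSubgroup α.FormalSum :=
  AddSubgroup.closure {x | ∃ (r s : S) (h : r ≼ s) (a : α.ideal r),
    x = α.delta r a - α.delta s ⟨a, α.ideal_mono h a.2⟩}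

theorem smul_mem_null (c : R) {x : α.FormalSum} (hx : x ∈ α.nullAddSubgroup) :
    c • x ∈ α.nullAddSubgroup := by
  induction hx using AddSubgroup.closure_induction with
  | mem x hx =>
    obtain ⟨r, s, h, a, rfl⟩ := hx
    refine AddSubgroup.subset_closure ⟨r, s, h, c • a, ?_⟩
    rw [smul_sub, ← map_smul, ← map_smul]
    rfl
  | zero => rw [smul_zero]; exact zero_mem _
  | add x y _ _ hx hy => rw [smul_add]; exact add_mem hx hy
  | neg x _ hx => rw [smul_neg]; exact neg_mem hx

/-- `𝓝(α)` as an `R`-submodule. -/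
def null : Submodule R α.FormalSum :=
  { α.nullAddSubgroup with smul_mem' := fun c _ hx => α.smul_mem_null c hx }

theorem coeff_congr_right {t r s : S} (b : α.ideal t) (a : α.ideal r) (a' : α.ideal s)
    (h : (a : A) = a') : α.coeff t r b a = α.coeff t s b a' := by
  simp only [coeff, h]

theorem coeff_congr_left {t r s : S} (b : α.ideal t) (a : α.ideal r) (a' : α.ideal s)
    (hrs : r ≼ s) (h : (a : A) = a') : α.coeff r t a b = α.coeff s t a' b := by
  obtain ⟨a, ha⟩ := a
  obtain ⟨a', ha'⟩ := a'
  obtain rfl : a = a' := h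
  have e1 : (α.map r⁻¹ ⟨a, by rw [inv_ideal_eq]; exact ha⟩ : A) =
      α.map s⁻¹ ⟨a, by rw [inv_ideal_eq]; exact ha'⟩ := by
    obtain ⟨_, h⟩ := α.isPartialHom.mono _ _ (natLE_inv hrs)
      ⟨a, show a ∈ α.ideal r⁻¹⁻¹ by rw [inv_ideal_eq]; exact ha⟩
    exact h.symm
  obtain ⟨_, h⟩ := α.isPartialHom.mono _ _ hrs
    ⟨(α.map r⁻¹ ⟨a, by rw [inv_ideal_eq]; exact ha⟩ : A) * b,
      α.mul_mem_right _ _ (α.map r⁻¹ _).2⟩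
  unfold coeff
  refine h.symm.trans ?_
  simp only [e1]
  rfl

theorem delta_sub_mem {r s : S} (h : r ≼ s) (a : α.ideal r) (b : α.ideal s) (hab : (a : A) = b) :
    α.delta r a - α.delta s b ∈ α.null := by
  refine AddSubgroup.subset_closure ⟨r, s, h, a, ?_⟩
  congr 2
  exact Subtype.ext hab.symm

theorem formalSum_induction {p : α.FormalSum → Prop} (x : α.FormalSum) (h0 : p 0)
    (hd : ∀ s a, p (α.delta s a)) (ha : ∀ x y, p x → p y → p (x + y)) : p x := by
  classical
  induction x using DirectSum.induction_on with
  | zero => exact h0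
  | of s a =>
    have := hd s a
    simp only [delta] at this
    convert this
    rw [DirectSum.lof_eq_of]
  | add x y hx hy => exact ha x y hx hy

/-- `𝓝(α)` is a left ideal. -/
theorem formalMul_mem_left (x : α.FormalSum) {y : α.FormalSum} (hy : y ∈ α.null) :
    α.formalMul x y ∈ α.null := by
  induction x using α.formalSum_induction with
  | h0 => rw [map_zero]; exact zero_mem _
  | ha x x' hx hx' => rw [map_add]; exact add_mem hx hx'
  | hd t b =>
    refine AddSubgroup.closure_induction (p := fun y _ => α.formalMul (α.delta t b) y ∈ α.null)
      ?_ ?_ ?_ ?_ hy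
    · rintro _ ⟨r, s, h, a, rfl⟩
      rw [map_sub, formalMul_delta, formalMul_delta]
      exact α.delta_sub_mem (natLE_mul_left t h) _ _ (α.coeff_congr_right _ _ _ rfl)
    · rw [map_zero]; exact zero_mem _
    · intro x y _ _ hx hy; rw [map_add]; exact add_mem hx hy
    · intro x _ hx; rw [map_neg]; exact neg_mem hx

/-- `𝓝(α)` is a right ideal. -/
theorem formalMul_mem_right {x : α.FormalSum} (y : α.FormalSum) (hx : x ∈ α.null) :
    α.formalMul x y ∈ α.null := by
  induction y using α.formalSum_induction with
  | h0 => rw [map_zero]; exact zero_mem _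
  | ha y y' hy hy' => rw [map_add]; exact add_mem hy hy'
  | hd t b =>
    refine AddSubgroup.closure_induction (p := fun x _ => α.formalMul x (α.delta t b) ∈ α.null)
      ?_ ?_ ?_ ?_ hx
    · rintro _ ⟨r, s, h, a, rfl⟩
      rw [map_sub, LinearMap.sub_apply, formalMul_delta, formalMul_delta]
      exact α.delta_sub_mem (natLE_mul_right t h) _ _ (α.coeff_congr_left _ _ _ h rfl)
    · rw [map_zero]; exact zero_mem _
    · intro x y _ _ hx hy; rw [map_add]; exact add_mem hx hy
    · intro x _ hx; rw [map_neg]; exact neg_mem hx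

/-- The crossed product `A ⋊_α S = 𝓛(α) / 𝓝(α)`. -/
def CrossedProduct : Type _ := α.FormalSum ⧸ α.null

noncomputable instance : AddCommGroup α.CrossedProduct :=
  inferInstanceAs (AddCommGroup (α.FormalSum ⧸ α.null))

noncomputable instance : Module R α.CrossedProduct :=
  inferInstanceAs (Module R (α.FormalSum ⧸ α.null))

/-- The class in `A ⋊_α S` of a formal sum. -/
noncomputable def toCrossed : α.FormalSum →ₗ[R] α.CrossedProduct := α.null.mkQ

/-- The multiplication of the crossed product, induced by that of `𝓛(α)`. -/
noncomputable def crossedMul : α.CrossedProduct →ₗ[R] α.CrossedProduct →ₗ[R] α.CrossedProduct :=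
  LinearMap.liftQ₂ α.null α.null (α.formalMul.compr₂ α.toCrossed)
    (fun _ hx => LinearMap.mem_ker.2 <| LinearMap.ext fun y =>
      (Submodule.Quotient.mk_eq_zero _).2 (α.formalMul_mem_right y hx))
    (fun _ hy => LinearMap.mem_ker.2 <| LinearMap.ext fun x =>
      (Submodule.Quotient.mk_eq_zero _).2 (α.formalMul_mem_left x hy))

noncomputable instance : NonUnitalNonAssocRing α.CrossedProduct where
  mul x y := α.crossedMul x y
  left_distrib x y z := map_add (α.crossedMul x) y z
  right_distrib x y z := LinearMap.map_add₂ α.crossedMul x y z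
  zero_mul x := LinearMap.map_zero₂ α.crossedMul x
  mul_zero x := map_zero (α.crossedMul x)

instance : IsScalarTower R α.CrossedProduct α.CrossedProduct :=
  ⟨fun c x y => LinearMap.map_smul₂ α.crossedMul c x y⟩

instance : SMulCommClass R α.CrossedProduct α.CrossedProduct :=
  ⟨fun c x y => (map_smul (α.crossedMul x) c y).symm⟩

theorem toCrossed_mul (x y : α.FormalSum) :
    α.toCrossed x * α.toCrossed y = α.toCrossed (α.formalMul x y) := rfl

end AlgPartialAction

/-! ### Topological groupoids and Steinberg algebras -/

/-- A topological groupoid with arrow space `G` and object space `X`. The product `mul a b` is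
defined exactly when `src a = rng b`; multiplication (on the subspace of composable pairs of
`G × G`) and inversion are continuous, and `X` is identified, via `unit`, with the subspace of
unit arrows. -/
structure TopologicalGroupoid (G X : Type*) [TopologicalSpace G] [TopologicalSpace X] where
  src : G → X
  rng : G → X
  unit : X → G
  mul : ∀ a b : G, src a = rng b → G
  inv : G → G
  src_unit : ∀ x, src (unit x) = x
  rng_unit : ∀ x, rng (unit x) = x
  src_mul : ∀ a b h, src (mul a b h) = src b
  rng_mul : ∀ a b h, rng (mul a b h) = rng a
  src_inv : ∀ a, src (inv a) = rng a
  rng_inv : ∀ a, rng (inv a) = src a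
  mul_assoc : ∀ a b c (hab : src a = rng b) (hbc : src b = rng c),
    mul (mul a b hab) c ((src_mul a b hab).trans hbc) =
      mul a (mul b c hbc) (hab.trans (rng_mul b c hbc).symm)
  unit_mul : ∀ a, mul (unit (rng a)) a (src_unit _) = a
  mul_unit : ∀ a, mul a (unit (src a)) (rng_unit _).symm = a
  inv_mul : ∀ a, mul (inv a) a (src_inv a) = unit (src a)
  mul_inv : ∀ a, mul a (inv a) (rng_inv a).symm = unit (rng a)
  isEmbedding_unit : IsEmbedding unit
  continuous_mul : Continuous fun p : {p : G × G // src p.1 = rng p.2} => mul p.1.1 p.1.2 p.2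
  continuous_inv : Continuous inv

namespace TopologicalGroupoid

variable {G X : Type*} [TopologicalSpace G] [TopologicalSpace X] (𝒢 : TopologicalGroupoid G X)

/-- An ample groupoid: étale, with Hausdorff unit space having a basis of compact-open sets. -/
class IsAmple : Prop where
  isLocalHomeomorph_src : IsLocalHomeomorph 𝒢.src
  t2Space : T2Space X
  isTopologicalBasis : IsTopologicalBasis {U : Set X | IsOpen U ∧ IsCompact U}

/-- Compact-open bisections: compact-open sets on which source and range are injective. -/
structure IsCompactOpenBisection (U : Set G) : Prop where
  isCompact : IsCompact U
  isOpen : IsOpen U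
  injOn_src : Set.InjOn 𝒢.src U
  injOn_rng : Set.InjOn 𝒢.rng U

theorem mul_congr {a a' b b' : G} (ha : a = a') (hb : b = b') (h : 𝒢.src a = 𝒢.rng b)
    (h' : 𝒢.src a' = 𝒢.rng b') : 𝒢.mul a b h = 𝒢.mul a' b' h' := by
  subst ha hb; rfl

theorem inv_mul_cancel (x b : G) (h : 𝒢.src x = 𝒢.rng b)
    (h' : 𝒢.src (𝒢.inv x) = 𝒢.rng (𝒢.mul x b h)) :
    𝒢.mul (𝒢.inv x) (𝒢.mul x b h) h' = b := by
  rw [← 𝒢.mul_assoc _ _ _ (𝒢.src_inv x) h,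
    𝒢.mul_congr ((𝒢.inv_mul x).trans (congrArg 𝒢.unit h)) rfl _ (𝒢.src_unit _), 𝒢.unit_mul]

theorem mul_inv_cancel (x a : G) (h : 𝒢.src (𝒢.inv x) = 𝒢.rng a)
    (h' : 𝒢.src x = 𝒢.rng (𝒢.mul (𝒢.inv x) a h)) :
    𝒢.mul x (𝒢.mul (𝒢.inv x) a h) h' = a := by
  rw [← 𝒢.mul_assoc _ _ _ (𝒢.rng_inv x).symm h,
    𝒢.mul_congr ((𝒢.mul_inv x).trans (congrArg 𝒢.unit ((𝒢.src_inv x).symm.trans h))) rfl _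
      (𝒢.src_unit _), 𝒢.unit_mul]

theorem inv_inv (a : G) : 𝒢.inv (𝒢.inv a) = a := by
  have h1 : 𝒢.src (𝒢.inv (𝒢.inv a)) = 𝒢.src a := by rw [𝒢.src_inv, 𝒢.rng_inv]
  have h := 𝒢.inv_mul_cancel (𝒢.inv a) a (𝒢.src_inv a)
    (by rw [h1, 𝒢.rng_mul, 𝒢.rng_inv])
  rw [𝒢.mul_congr rfl ((𝒢.inv_mul a).trans (congrArg 𝒢.unit h1.symm)) _ (𝒢.rng_unit _).symm,
    𝒢.mul_unit] at h
  exact h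

/-- The convolution product `(f * g)(a) = ∑_{x ∈ r⁻¹(r(a))} f(x) g(x⁻¹ a)`. -/
noncomputable def convolution {R : Type*} [CommRing R] (f g : G → R) : G → R := fun a =>
  ∑ᶠ x : {x : G // 𝒢.rng x = 𝒢.rng a},
    f x * g (𝒢.mul (𝒢.inv x) a ((𝒢.src_inv x).trans x.2))

/-- The underlying module of `A_R(𝒢)`: the span of the characteristic functions of compact-open
bisections. -/
def steinbergSubmodule (R : Type*) [CommRing R] : Submodule R (G → R) :=
  Submodule.span R {f | ∃ U : Set G, 𝒢.IsCompactOpenBisection U ∧ f = U.indicator 1}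

section Proofs

variable {𝒢}

theorem continuous_src : Continuous 𝒢.src := by
  rw [𝒢.isEmbedding_unit.continuous_iff]
  have : 𝒢.unit ∘ 𝒢.src = fun a => 𝒢.mul (𝒢.inv a) a (𝒢.src_inv a) := by
    funext a; exact (𝒢.inv_mul a).symm
  rw [this]
  exact 𝒢.continuous_mul.comp (f := fun a => ⟨(𝒢.inv a, a), 𝒢.src_inv a⟩)
    ((𝒢.continuous_inv.prodMk continuous_id).subtype_mk _)

theorem continuous_rng : Continuous 𝒢.rng := by
  have : 𝒢.rng = 𝒢.src ∘ 𝒢.inv := by funext a; exact (𝒢.src_inv a).symm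
  rw [this]; exact continuous_src.comp 𝒢.continuous_inv

theorem isOpenMap_rng [𝒢.IsAmple] : IsOpenMap 𝒢.rng := by
  intro U hU
  have : 𝒢.rng '' U = 𝒢.src '' (𝒢.inv ⁻¹' U) := by
    ext x
    constructor
    · rintro ⟨a, ha, rfl⟩
      exact ⟨𝒢.inv a, by simpa [inv_inv] using ha, 𝒢.src_inv a⟩
    · rintro ⟨a, ha, rfl⟩
      exact ⟨𝒢.inv a, ha, 𝒢.rng_inv a⟩
  rw [this]
  exact (IsAmple.isLocalHomeomorph_src (𝒢 := 𝒢)).isOpenMap _ (hU.preimage 𝒢.continuous_inv)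

/-- The product of two sets of arrows. -/
def mulSet (𝒢 : TopologicalGroupoid G X) (U V : Set G) : Set G :=
  {c | ∃ a ∈ U, ∃ b ∈ V, ∃ h, c = 𝒢.mul a b h}

theorem isOpen_mulSet [𝒢.IsAmple] {U V : Set G} (hU : IsOpen U) (hV : IsOpen V)
    (hr : Set.InjOn 𝒢.rng U) : IsOpen (𝒢.mulSet U V) := by
  classical
  let W := 𝒢.rng ⁻¹' (𝒢.rng '' U)
  have hW : IsOpen W := (isOpenMap_rng U hU).preimage continuous_rng
  choose σ hσU hσ using fun c : W => c.2
  have hσc : Continuous σ := by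
    rw [continuous_def]
    intro O hO
    have : σ ⁻¹' O = Subtype.val ⁻¹' (𝒢.rng ⁻¹' (𝒢.rng '' (U ∩ O))) := by
      ext c
      constructor
      · intro hc
        exact ⟨σ c, ⟨hσU c, hc⟩, hσ c⟩
      · rintro ⟨a, ⟨haU, haO⟩, ha⟩
        have : σ c = a := hr (hσU c) haU ((hσ c).trans ha.symm)
        simpa [this] using haO
    rw [this]
    exact ((isOpenMap_rng _ (hU.inter hO)).preimage continuous_rng).preimage
      continuous_subtype_val
  have hs : ∀ c : W, 𝒢.src (𝒢.inv (σ c)) = 𝒢.rng c := fun c => (𝒢.src_inv _).trans (hσ c)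
  let τ : W → G := fun c => 𝒢.mul (𝒢.inv (σ c)) c (hs c)
  have hτ : Continuous τ := 𝒢.continuous_mul.comp
    (f := fun c : W => (⟨(𝒢.inv (σ c), c), hs c⟩ : {p : G × G // 𝒢.src p.1 = 𝒢.rng p.2}))
    (((𝒢.continuous_inv.comp hσc).prodMk continuous_subtype_val).subtype_mk _)
  have : 𝒢.mulSet U V = Subtype.val '' (τ ⁻¹' V) := by
    ext c
    constructor
    · rintro ⟨a, ha, b, hb, h, rfl⟩
      have hw : 𝒢.mul a b h ∈ W := ⟨a, ha, (𝒢.rng_mul a b h).symm⟩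
      refine ⟨⟨_, hw⟩, ?_, rfl⟩
      have : σ ⟨_, hw⟩ = a := hr (hσU _) ha ((hσ _).trans (𝒢.rng_mul a b h))
      change 𝒢.mul _ _ _ ∈ V
      rw [𝒢.mul_congr (congrArg 𝒢.inv this) rfl _ ((𝒢.src_inv _).trans (𝒢.rng_mul a b h).symm),
        𝒢.inv_mul_cancel]
      exact hb
    · rintro ⟨c, hc, rfl⟩
      refine ⟨σ c, hσU c, τ c, hc, ?_, ?_⟩
      · exact ((𝒢.rng_mul _ _ _).trans (𝒢.rng_inv _)).symm
      · exact (𝒢.mul_inv_cancel _ _ _ _).symm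
  rw [this]
  exact hW.isOpenMap_subtype_val _ (hV.preimage hτ)

theorem isCompact_mulSet [𝒢.IsAmple] {U V : Set G} (hU : IsCompact U) (hV : IsCompact V) :
    IsCompact (𝒢.mulSet U V) := by
  have := IsAmple.t2Space (𝒢 := 𝒢)
  have hcl : IsClosed {p : G × G | 𝒢.src p.1 = 𝒢.rng p.2} :=
    isClosed_eq (continuous_src.comp continuous_fst) (continuous_rng.comp continuous_snd)
  have hK : IsCompact ((Subtype.val : {p : G × G // 𝒢.src p.1 = 𝒢.rng p.2} → G × G) ⁻¹' (U ×ˢ V)) :=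
    hcl.isClosedEmbedding_subtypeVal.isCompact_preimage (hU.prod hV)
  convert hK.image 𝒢.continuous_mul using 1
  ext c
  constructor
  · rintro ⟨a, ha, b, hb, h, rfl⟩
    exact ⟨⟨(a, b), h⟩, ⟨ha, hb⟩, rfl⟩
  · rintro ⟨⟨⟨a, b⟩, h⟩, ⟨ha, hb⟩, rfl⟩
    exact ⟨a, ha, b, hb, h, rfl⟩

theorem IsCompactOpenBisection.mulSet [𝒢.IsAmple] {U V : Set G} (hU : 𝒢.IsCompactOpenBisection U)
    (hV : 𝒢.IsCompactOpenBisection V) : 𝒢.IsCompactOpenBisection (𝒢.mulSet U V) where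
  isCompact := isCompact_mulSet hU.isCompact hV.isCompact
  isOpen := isOpen_mulSet hU.isOpen hV.isOpen hU.injOn_rng
  injOn_src := by
    rintro _ ⟨a, ha, b, hb, h, rfl⟩ _ ⟨a', ha', b', hb', h', rfl⟩ e
    rw [𝒢.src_mul, 𝒢.src_mul] at e
    obtain rfl := hV.injOn_src hb hb' e
    obtain rfl := hU.injOn_src ha ha' (h.trans h'.symm)
    rfl
  injOn_rng := by
    rintro _ ⟨a, ha, b, hb, h, rfl⟩ _ ⟨a', ha', b', hb', h', rfl⟩ e
    rw [𝒢.rng_mul, 𝒢.rng_mul] at e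
    obtain rfl := hU.injOn_rng ha ha' e
    obtain rfl := hV.injOn_rng hb hb' (h.symm.trans h')
    rfl

variable {R : Type*} [CommRing R]

/-- Elements of `A_R(𝒢)` have finite support in each range fibre, so that the sums defining the
convolution product are finite. -/
theorem finite_support_fibre {f : G → R} (hf : f ∈ 𝒢.steinbergSubmodule R) (y : X) :
    (Function.support fun x : {x : G // 𝒢.rng x = y} => f x).Finite := by
  induction hf using Submodule.span_induction with
  | mem f hf =>
    obtain ⟨U, hU, rfl⟩ := hf
    refine Set.Subsingleton.finite ?_
    rintro ⟨a, ha⟩ h ⟨b, hb⟩ h'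
    have ha' : a ∈ U := Set.mem_of_indicator_ne_zero h
    have hb' : b ∈ U := Set.mem_of_indicator_ne_zero h'
    exact Subtype.ext (hU.injOn_rng ha' hb' (ha.trans hb.symm))
  | zero => simp
  | add f g _ _ hf hg => exact (hf.union hg).subset (Function.support_add _ _)
  | smul c f _ hf => exact hf.subset (Function.support_const_smul_subset c _)

theorem finite_support_conv {f : G → R} (hf : f ∈ 𝒢.steinbergSubmodule R) (g : G → R) (a : G) :
    (Function.support fun x : {x : G // 𝒢.rng x = 𝒢.rng a} =>
      f x * g (𝒢.mul (𝒢.inv x) a ((𝒢.src_inv x).trans x.2))).Finite :=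
  (finite_support_fibre hf _).subset fun x hx h => hx (by
    change f x = 0 at h
    simp only [h, zero_mul])

theorem convolution_add_left {f f' : G → R} (hf : f ∈ 𝒢.steinbergSubmodule R)
    (hf' : f' ∈ 𝒢.steinbergSubmodule R) (g : G → R) :
    𝒢.convolution (f + f') g = 𝒢.convolution f g + 𝒢.convolution f' g := by
  funext a
  simp only [convolution, Pi.add_apply, add_mul]
  exact finsum_add_distrib (finite_support_conv hf g a) (finite_support_conv hf' g a)

theorem convolution_add_right {f : G → R} (hf : f ∈ 𝒢.steinbergSubmodule R) (g g' : G → R) :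
    𝒢.convolution f (g + g') = 𝒢.convolution f g + 𝒢.convolution f g' := by
  funext a
  simp only [convolution, Pi.add_apply, mul_add]
  exact finsum_add_distrib (finite_support_conv hf g a) (finite_support_conv hf g' a)

theorem convolution_smul_left (c : R) {f : G → R} (hf : f ∈ 𝒢.steinbergSubmodule R) (g : G → R) :
    𝒢.convolution (c • f) g = c • 𝒢.convolution f g := by
  funext a
  simp only [convolution, Pi.smul_apply, smul_eq_mul, _root_.mul_assoc]
  exact (mul_finsum' _ c (finite_support_conv hf g a)).symm

theorem convolution_smul_right (c : R) {f : G → R} (hf : f ∈ 𝒢.steinbergSubmodule R) (g : G → R) :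
    𝒢.convolution f (c • g) = c • 𝒢.convolution f g := by
  funext a
  simp only [convolution, Pi.smul_apply, smul_eq_mul, mul_left_comm _ c]
  exact (mul_finsum' _ c (finite_support_conv hf g a)).symm

theorem convolution_zero_left (g : G → R) : 𝒢.convolution 0 g = 0 := by
  funext a
  simp [convolution]

theorem convolution_zero_right (f : G → R) : 𝒢.convolution f 0 = 0 := by
  funext a
  simp [convolution]

/-- `1_U * 1_V = 1_{UV}`. -/
theorem convolution_indicator {U : Set G} (hU : Set.InjOn 𝒢.rng U) (V : Set G) :
    𝒢.convolution (U.indicator (1 : G → R)) (V.indicator 1) = (𝒢.mulSet U V).indicator 1 := by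
  classical
  funext c
  by_cases hc : c ∈ 𝒢.mulSet U V
  · rw [Set.indicator_of_mem hc]
    obtain ⟨a, ha, b, hb, h, rfl⟩ := hc
    unfold convolution
    rw [finsum_eq_single _ ⟨a, (𝒢.rng_mul a b h).symm⟩]
    · rw [𝒢.inv_mul_cancel, Set.indicator_of_mem ha, Set.indicator_of_mem hb]
      simp
    · rintro ⟨x, hx⟩ hne
      rw [Set.indicator_of_notMem, zero_mul]
      intro hxU
      exact hne (Subtype.ext (hU hxU ha (hx.trans (𝒢.rng_mul a b h))))
  · rw [Set.indicator_of_notMem hc]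
    unfold convolution
    rw [finsum_eq_zero_of_forall_eq_zero]
    rintro ⟨x, hx⟩
    by_contra hne
    have h1 : x ∈ U := Set.mem_of_indicator_ne_zero (left_ne_zero_of_mul hne)
    have h2 := Set.mem_of_indicator_ne_zero (right_ne_zero_of_mul hne)
    exact hc ⟨x, h1, _, h2, ((𝒢.rng_mul _ _ _).trans (𝒢.rng_inv _)).symm,
      (𝒢.mul_inv_cancel _ _ _ _).symm⟩

theorem convolution_mem [𝒢.IsAmple] {f g : G → R} (hf : f ∈ 𝒢.steinbergSubmodule R)
    (hg : g ∈ 𝒢.steinbergSubmodule R) : 𝒢.convolution f g ∈ 𝒢.steinbergSubmodule R := by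
  induction hf using Submodule.span_induction with
  | zero => rw [convolution_zero_left]; exact zero_mem _
  | add f f' hf hf' h h' => rw [convolution_add_left hf hf']; exact add_mem h h'
  | smul c f hf h => rw [convolution_smul_left c hf]; exact Submodule.smul_mem _ c h
  | mem f hf =>
    have hf' := Submodule.subset_span (R := R) hf
    obtain ⟨U, hU, rfl⟩ := hf
    induction hg using Submodule.span_induction with
    | zero => rw [convolution_zero_right]; exact zero_mem _
    | add g g' _ _ h h' => rw [convolution_add_right hf']; exact add_mem h h'
    | smul c g _ h => rw [convolution_smul_right c hf']; exact Submodule.smul_mem _ c h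
    | mem g hg =>
      obtain ⟨V, hV, rfl⟩ := hg
      rw [convolution_indicator hU.injOn_rng]
      exact Submodule.subset_span ⟨_, hU.mulSet hV, rfl⟩

end Proofs

/-- The Steinberg algebra `A_R(𝒢)` of an ample groupoid, with the convolution product. -/
def SteinbergAlgebra (R : Type*) [CommRing R] [𝒢.IsAmple] : Type _ := 𝒢.steinbergSubmodule R

variable (R : Type*) [CommRing R] [𝒢.IsAmple]

noncomputable instance : AddCommGroup (𝒢.SteinbergAlgebra R) :=
  inferInstanceAs (AddCommGroup (𝒢.steinbergSubmodule R))

noncomputable instance : Module R (𝒢.SteinbergAlgebra R) :=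
  inferInstanceAs (Module R (𝒢.steinbergSubmodule R))

noncomputable instance : NonUnitalNonAssocRing (𝒢.SteinbergAlgebra R) where
  mul f g := ⟨𝒢.convolution f.1 g.1, convolution_mem f.2 g.2⟩
  left_distrib f g h := Subtype.ext (convolution_add_right f.2 g.1 h.1)
  right_distrib f g h := Subtype.ext (convolution_add_left f.2 g.2 h.1)
  zero_mul f := Subtype.ext (convolution_zero_left f.1)
  mul_zero f := Subtype.ext (convolution_zero_right f.1)

instance : IsScalarTower R (𝒢.SteinbergAlgebra R) (𝒢.SteinbergAlgebra R) :=
  ⟨fun c f g => Subtype.ext (convolution_smul_left c f.2 g.1)⟩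

instance : SMulCommClass R (𝒢.SteinbergAlgebra R) (𝒢.SteinbergAlgebra R) :=
  ⟨fun c f g => Subtype.ext (convolution_smul_right c f.2 g.1).symm⟩

end TopologicalGroupoid

/-! ### The groupoid of germs -/

namespace TopPartialAction

variable {S X : Type*} [InverseSemigroup S] [TopologicalSpace X] (θ : TopPartialAction S X)

/-- `S ∗ X = {(s, x) : x ∈ X_{s*}}`. -/
abbrev Pairs : Type _ := {p : S × X // p.2 ∈ θ.dom p.1⁻¹}

/-- The germ relation: `(s, x) ∼ (t, y)` iff `x = y` and there is `u ≤ s, t` with `x ∈ X_{u*}`. -/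
def GermRel (p q : θ.Pairs) : Prop :=
  p.1.2 = q.1.2 ∧ ∃ u : S, u ≼ p.1.1 ∧ u ≼ q.1.1 ∧ p.1.2 ∈ θ.dom u⁻¹

theorem mem_of_natLE {u s : S} (h : u ≼ s) {x : X} (hx : x ∈ θ.dom u⁻¹) : x ∈ θ.dom s⁻¹ :=
  (θ.isPartialHom.mono u s h ⟨x, hx⟩).1

theorem map_of_natLE {u s : S} (h : u ≼ s) {x : X} (hx : x ∈ θ.dom u⁻¹) :
    (θ.map s ⟨x, θ.mem_of_natLE h hx⟩ : X) = θ.map u ⟨x, hx⟩ :=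
  (θ.isPartialHom.mono u s h ⟨x, hx⟩).2

theorem map_mem (s : S) (x : θ.dom s⁻¹) : (θ.map s x : X) ∈ θ.dom s⁻¹⁻¹ :=
  (θ.isPartialHom.inv s x).1

theorem map_inv_map (s : S) (x : θ.dom s⁻¹) :
    (θ.map s⁻¹ ⟨θ.map s x, θ.map_mem s x⟩ : X) = x :=
  (θ.isPartialHom.inv s x).2

theorem mem_mul (s t : S) (x : θ.dom t⁻¹) (hx : (θ.map t x : X) ∈ θ.dom s⁻¹) :
    (x : X) ∈ θ.dom (s * t)⁻¹ :=
  (θ.isPartialHom.mul s t x hx).1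

theorem map_mul (s t : S) (x : θ.dom t⁻¹) (hx : (θ.map t x : X) ∈ θ.dom s⁻¹) :
    (θ.map (s * t) ⟨x, θ.mem_mul s t x hx⟩ : X) = θ.map s ⟨θ.map t x, hx⟩ :=
  (θ.isPartialHom.mul s t x hx).2

theorem map_idem {e : S} (he : e * e = e) (x : θ.dom e⁻¹) : (θ.map e x : X) = x :=
  θ.isPartialHom.idem_apply he x

theorem map_congr (s : S) {x y : θ.dom s⁻¹} (h : (x : X) = y) : (θ.map s x : X) = θ.map s y := by
  rw [Subtype.ext h]

theorem germRel_equivalence : Equivalence θ.GermRel where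
  refl p := ⟨rfl, p.1.1, natLE_refl _, natLE_refl _, p.2⟩
  symm := by
    rintro p q ⟨h, u, h1, h2, h3⟩
    exact ⟨h.symm, u, h2, h1, h ▸ h3⟩
  trans := by
    rintro p q r ⟨h, u, h1, h2, h3⟩ ⟨h', v, h1', h2', h3'⟩
    have hv := inv_mul_idem v
    have hx : p.1.2 ∈ θ.dom (v⁻¹ * v)⁻¹ := by
      rw [inv_idem hv]
      exact θ.isPartialHom.mem_source_idem v ⟨p.1.2, h.symm ▸ h3'⟩
    refine ⟨h.trans h', u * (v⁻¹ * v), natLE_trans (mul_idem_natLE u hv) h1, ?_, ?_⟩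
    · refine natLE_trans (natLE_mul_right _ h2) ?_
      have : q.1.1 * (v⁻¹ * v) = v := by rw [← mul_assoc]; exact h1'.symm
      rw [this]
      exact h2'
    · refine θ.mem_mul u (v⁻¹ * v) ⟨_, hx⟩ ?_
      rw [θ.map_idem hv]
      exact h3

/-- The equivalence relation on `S ∗ X` whose classes are the germs. -/
def germSetoid : Setoid θ.Pairs := ⟨θ.GermRel, θ.germRel_equivalence⟩

/-- The set of arrows of `S ⋉ X`. -/
def Germ : Type _ := Quotient θ.germSetoid

variable {θ}

/-- The germ `[s, x]` of `s` at `x ∈ X_{s*}`. -/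
def germ (s : S) (x : X) (hx : x ∈ θ.dom s⁻¹) : θ.Germ := Quotient.mk θ.germSetoid ⟨(s, x), hx⟩

theorem germ_eq_germ {s t : S} {x y : X} {hx : x ∈ θ.dom s⁻¹} {hy : y ∈ θ.dom t⁻¹} :
    germ s x hx = germ t y hy ↔ x = y ∧ ∃ u : S, u ≼ s ∧ u ≼ t ∧ x ∈ θ.dom u⁻¹ :=
  ⟨fun h => Quotient.exact h, fun h => Quotient.sound (s := θ.germSetoid) h⟩

theorem germ_eq_of_natLE {u s : S} (h : u ≼ s) {x : X} (hx : x ∈ θ.dom u⁻¹) :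
    germ u x hx = germ s x (θ.mem_of_natLE h hx) :=
  germ_eq_germ.2 ⟨rfl, u, natLE_refl u, h, hx⟩

theorem germ_congr {s t : S} {x y : X} (hst : s = t) (hxy : x = y) (hx : x ∈ θ.dom s⁻¹)
    (hy : y ∈ θ.dom t⁻¹) : germ s x hx = germ t y hy := by
  subst hst hxy; rfl

theorem exists_germ (a : θ.Germ) : ∃ (s : S) (x : X) (hx : x ∈ θ.dom s⁻¹), a = germ s x hx := by
  induction a using Quotient.inductionOn with
  | h p => exact ⟨p.1.1, p.1.2, p.2, rfl⟩

namespace Germ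

/-- `s[s, x] = x`. -/
def src (a : θ.Germ) : X := Quotient.lift (fun p : θ.Pairs => p.1.2) (fun p q (h : θ.GermRel p q) => h.1) a

/-- `r[s, x] = θ_s(x)`. -/
def rng (a : θ.Germ) : X :=
  Quotient.lift (fun p : θ.Pairs => (θ.map p.1.1 ⟨p.1.2, p.2⟩ : X)) (by
    rintro ⟨⟨s, x⟩, hx⟩ ⟨⟨t, y⟩, hy⟩ ⟨h, u, h1, h2, h3⟩
    obtain rfl : x = y := h
    exact (θ.map_of_natLE h1 h3).trans (θ.map_of_natLE h2 h3).symm) a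

@[simp] theorem src_germ (s : S) (x : X) (hx : x ∈ θ.dom s⁻¹) : src (germ s x hx) = x := rfl

@[simp] theorem rng_germ (s : S) (x : X) (hx : x ∈ θ.dom s⁻¹) :
    rng (germ s x hx) = θ.map s ⟨x, hx⟩ := rfl

theorem exists_idem (θ : TopPartialAction S X) (x : X) : ∃ e : S, e * e = e ∧ x ∈ θ.dom e⁻¹ := by
  have : x ∈ ⋃ e ∈ {e : S | e * e = e}, θ.dom e := by rw [θ.nondegenerate]; trivial
  simp only [Set.mem_iUnion, Set.mem_ofPred_eq] at this
  obtain ⟨e, he, hx⟩ := this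
  exact ⟨e, he, by rwa [inv_idem he]⟩

/-- The unit `[e, x]` at `x`, for any idempotent `e` with `x ∈ X_e`. -/
noncomputable def unit (x : X) : θ.Germ :=
  germ (exists_idem θ x).choose x (exists_idem θ x).choose_spec.2

theorem unit_eq {e : S} (he : e * e = e) (x : X) (hx : x ∈ θ.dom e⁻¹) : unit x = germ e x hx := by
  have hf := (exists_idem θ x).choose_spec.1
  have hxf := (exists_idem θ x).choose_spec.2
  set f := (exists_idem θ x).choose
  refine germ_eq_germ.2 ⟨rfl, f * e, mul_idem_natLE f he, idem_mul_natLE e hf, ?_⟩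
  refine θ.mem_mul f e ⟨x, hx⟩ ?_
  rw [θ.map_idem he]
  exact hxf

theorem pairs_mem (p q : θ.Pairs) (h : p.1.2 = θ.map q.1.1 ⟨q.1.2, q.2⟩) :
    q.1.2 ∈ θ.dom (p.1.1 * q.1.1)⁻¹ :=
  θ.mem_mul p.1.1 q.1.1 ⟨q.1.2, q.2⟩ (h ▸ p.2)

/-- The product of two composable germs, computed on representatives: see `mul_germ`. -/
noncomputable def mul (a b : θ.Germ) (h : src a = rng b) : θ.Germ :=
  germ ((Quotient.out a).1.1 * (Quotient.out b).1.1) (Quotient.out b).1.2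
    (pairs_mem _ _ (by
      rw [← Quotient.out_eq a, ← Quotient.out_eq b] at h
      exact h))

/-- `[s, x][t, y] = [s t, y]` whenever `x = θ_t(y)`. -/
theorem mul_germ (s t : S) (x y : X) (hx : x ∈ θ.dom s⁻¹) (hy : y ∈ θ.dom t⁻¹)
    (h : x = θ.map t ⟨y, hy⟩) :
    mul (germ s x hx) (germ t y hy) h =
      germ (s * t) y (θ.mem_mul s t ⟨y, hy⟩ (h ▸ hx)) := by
  obtain ⟨e1, u, hu1, hu2, hu3⟩ := Quotient.mk_out (s := θ.germSetoid) ⟨(s, x), hx⟩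
  obtain ⟨e2, v, hv1, hv2, hv3⟩ := Quotient.mk_out (s := θ.germSetoid) ⟨(t, y), hy⟩
  refine germ_eq_germ.2 ⟨e2, u * v, ?_, ?_, ?_⟩
  · exact natLE_trans (natLE_mul_right _ hu1) (natLE_mul_left _ hv1)
  · exact natLE_trans (natLE_mul_right _ hu2) (natLE_mul_left _ hv2)
  · refine θ.mem_mul u v ⟨_, hv3⟩ ?_
    rw [← θ.map_of_natLE hv2 hv3]
    have h3 := θ.map_congr t (x := ⟨_, θ.mem_of_natLE hv2 hv3⟩) (y := ⟨y, hy⟩) e2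
    rw [h3, ← h]
    exact (show x = _ from e1.symm) ▸ hu3

theorem mul_eq {a b : θ.Germ} (h : src a = rng b) {s t : S} {x y : X} {hx : x ∈ θ.dom s⁻¹}
    {hy : y ∈ θ.dom t⁻¹} (ha : a = germ s x hx) (hb : b = germ t y hy)
    (h' : x = θ.map t ⟨y, hy⟩) :
    mul a b h = germ (s * t) y (θ.mem_mul s t ⟨y, hy⟩ (h' ▸ hx)) := by
  subst ha hb
  exact mul_germ s t x y hx hy h'

/-- `[s, x]⁻¹ = [s*, θ_s(x)]`. -/
def inv (a : θ.Germ) : θ.Germ :=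
  Quotient.lift (fun p : θ.Pairs =>
    (germ p.1.1⁻¹ (θ.map p.1.1 ⟨p.1.2, p.2⟩ : X) (θ.map_mem _ _) : θ.Germ)) (by
    rintro ⟨⟨s, x⟩, hx⟩ ⟨⟨t, y⟩, hy⟩ ⟨h, u, h1, h2, h3⟩
    obtain rfl : x = y := h
    refine germ_eq_germ.2 ⟨?_, u⁻¹, natLE_inv h1, natLE_inv h2, ?_⟩
    · exact (θ.map_of_natLE h1 h3).trans (θ.map_of_natLE h2 h3).symm
    · have := θ.map_of_natLE h1 h3
      change (θ.map s ⟨x, _⟩ : X) ∈ _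
      rw [this]
      exact θ.map_mem u ⟨x, h3⟩) a

theorem inv_germ (s : S) (x : X) (hx : x ∈ θ.dom s⁻¹) :
    inv (germ s x hx) = (germ s⁻¹ (θ.map s ⟨x, hx⟩) (θ.map_mem _ _) : θ.Germ) := rfl

end Germ

open TopPartialAction.Germ

/-- The set `[s, U] = {[s, x] : x ∈ U}`. -/
def germSet (s : S) (U : Set X) : Set θ.Germ :=
  {a | ∃ (x : X) (hx : x ∈ θ.dom s⁻¹), x ∈ U ∧ a = germ s x hx}

/-- The germ topology, with basis the sets `[s, U]` for `U ⊆ X_{s*}` open. -/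
instance : TopologicalSpace θ.Germ :=
  generateFrom {O | ∃ (s : S) (U : Set X), IsOpen U ∧ U ⊆ θ.dom s⁻¹ ∧ O = germSet s U}

theorem isOpen_iff {O : Set θ.Germ} :
    IsOpen O ↔ ∀ s : S, IsOpen {x : X | ∃ hx : x ∈ θ.dom s⁻¹, germ s x hx ∈ O} := by
  constructor
  · intro h s
    induction h with
    | basic O hO =>
      obtain ⟨t, U, hU, -, rfl⟩ := hO
      have : {x : X | ∃ hx : x ∈ θ.dom s⁻¹, germ s x hx ∈ germSet t U} =
          ⋃ u ∈ {u : S | u ≼ s ∧ u ≼ t}, θ.dom u⁻¹ ∩ U := by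
        ext x
        simp only [Set.mem_ofPred_eq, Set.mem_iUnion, Set.mem_inter_iff, exists_prop]
        constructor
        · rintro ⟨hx, y, hy, hyU, e⟩
          obtain ⟨rfl, u, h1, h2, h3⟩ := germ_eq_germ.1 e
          exact ⟨u, ⟨h1, h2⟩, h3, hyU⟩
        · rintro ⟨u, ⟨h1, h2⟩, h3, hxU⟩
          exact ⟨θ.mem_of_natLE h1 h3, x, θ.mem_of_natLE h2 h3, hxU,
            germ_eq_germ.2 ⟨rfl, u, h1, h2, h3⟩⟩
      rw [this]
      exact isOpen_biUnion fun u _ => (θ.isOpen_dom _).inter hU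
    | univ => simpa using θ.isOpen_dom s⁻¹
    | inter O O' _ _ h h' =>
      convert h.inter h' using 1
      ext x
      simp only [Set.mem_inter_iff, Set.mem_ofPred_eq]
      constructor
      · rintro ⟨hx, h1, h2⟩; exact ⟨⟨hx, h1⟩, hx, h2⟩
      · rintro ⟨⟨hx, h1⟩, _, h2⟩; exact ⟨hx, h1, h2⟩
    | sUnion F _ h =>
      have : {x : X | ∃ hx : x ∈ θ.dom s⁻¹, germ s x hx ∈ ⋃₀ F} =
          ⋃ O ∈ F, {x : X | ∃ hx : x ∈ θ.dom s⁻¹, germ s x hx ∈ O} := by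
        ext x
        simp only [Set.mem_ofPred_eq, Set.mem_iUnion, Set.mem_sUnion, exists_prop]
        constructor
        · rintro ⟨hx, O, hO, h⟩; exact ⟨O, hO, hx, h⟩
        · rintro ⟨O, hO, hx, h⟩; exact ⟨hx, O, hO, h⟩
      rw [this]
      exact isOpen_biUnion h
  · intro h
    have : O = ⋃ s : S, germSet s {x : X | ∃ hx : x ∈ θ.dom s⁻¹, germ s x hx ∈ O} := by
      ext a
      simp only [Set.mem_iUnion]
      constructor
      · intro ha
        obtain ⟨s, x, hx, rfl⟩ := exists_germ a
        exact ⟨s, x, hx, ⟨hx, ha⟩, rfl⟩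
      · rintro ⟨s, x, hx, ⟨_, h⟩, rfl⟩
        exact h
    rw [this]
    exact isOpen_iUnion fun s =>
      isOpen_generateFrom_of_mem ⟨s, _, h s, fun x hx => hx.1, rfl⟩

theorem isOpen_germSet (s : S) {U : Set X} (hU : IsOpen U) : IsOpen (germSet (θ := θ) s U) := by
  have : germSet (θ := θ) s U = germSet s (U ∩ θ.dom s⁻¹) := by
    ext a
    constructor
    · rintro ⟨x, hx, h, rfl⟩; exact ⟨x, hx, ⟨h, hx⟩, rfl⟩
    · rintro ⟨x, hx, h, rfl⟩; exact ⟨x, hx, h.1, rfl⟩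
  rw [this]
  exact isOpen_generateFrom_of_mem
    ⟨s, _, hU.inter (θ.isOpen_dom _), Set.inter_subset_right, rfl⟩

theorem isTopologicalBasis_germSet : IsTopologicalBasis
    {O : Set θ.Germ | ∃ (s : S) (U : Set X), IsOpen U ∧ U ⊆ θ.dom s⁻¹ ∧ O = germSet s U} := by
  refine isTopologicalBasis_of_isOpen_of_nhds ?_ ?_
  · rintro _ ⟨s, U, hU, -, rfl⟩
    exact isOpen_germSet s hU
  · intro a O ha hO
    obtain ⟨s, x, hx, rfl⟩ := exists_germ a
    refine ⟨_, ⟨s, _, isOpen_iff.1 hO s, fun x hx => hx.1, rfl⟩, ⟨x, hx, ⟨hx, ha⟩, rfl⟩, ?_⟩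
    rintro _ ⟨y, hy, ⟨_, h⟩, rfl⟩
    exact h

theorem continuous_src : Continuous (src (θ := θ)) := by
  rw [continuous_def]
  intro U hU
  rw [isOpen_iff]
  intro s
  convert (θ.isOpen_dom s⁻¹).inter hU using 1
  ext x
  simp

theorem isOpenMap_src : IsOpenMap (src (θ := θ)) := by
  intro O hO
  have : src '' O = ⋃ s : S, {x : X | ∃ hx : x ∈ θ.dom s⁻¹, germ s x hx ∈ O} := by
    ext x
    simp only [Set.mem_iUnion]
    constructor
    · rintro ⟨a, ha, rfl⟩
      obtain ⟨s, x, hx, rfl⟩ := exists_germ a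
      exact ⟨s, hx, ha⟩
    · rintro ⟨s, hx, h⟩
      exact ⟨_, h, rfl⟩
  rw [this]
  exact isOpen_iUnion (isOpen_iff.1 hO)

theorem isLocalHomeomorph_src : IsLocalHomeomorph (src (θ := θ)) := by
  rw [isLocalHomeomorph_iff_isOpenEmbedding_restrict]
  intro a
  obtain ⟨s, x, hx, rfl⟩ := exists_germ a
  have hO := isOpen_germSet (θ := θ) s isOpen_univ
  refine ⟨germSet s Set.univ, hO.mem_nhds ⟨x, hx, trivial, rfl⟩,
    .of_continuous_injective_isOpenMap (continuous_src.comp continuous_subtype_val) ?_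
      (isOpenMap_src.comp hO.isOpenMap_subtype_val)⟩
  rintro ⟨_, y, hy, _, rfl⟩ ⟨_, z, hz, _, rfl⟩ e
  obtain rfl : y = z := e
  rfl

theorem continuous_unit : Continuous (unit (θ := θ)) := by
  rw [continuous_def]
  intro O hO
  have : unit ⁻¹' O =
      ⋃ e ∈ {e : S | e * e = e}, {x : X | ∃ hx : x ∈ θ.dom e⁻¹, germ e x hx ∈ O} := by
    ext x
    simp only [Set.mem_iUnion, Set.mem_ofPred_eq, exists_prop, Set.mem_preimage]
    constructor
    · intro h
      obtain ⟨e, he, hx⟩ := exists_idem θ x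
      exact ⟨e, he, hx, by rwa [← unit_eq he]⟩
    · rintro ⟨e, he, hx, h⟩
      rwa [unit_eq he x hx]
  rw [this]
  exact isOpen_biUnion fun e _ => isOpen_iff.1 hO e

theorem continuous_inv : Continuous (Germ.inv (θ := θ)) := by
  rw [continuous_def]
  intro O hO
  rw [isOpen_iff]
  intro s
  have h1 := (isOpen_iff.1 hO s⁻¹).preimage
    (continuous_subtype_val.comp (θ.map s).continuous)
  have h2 := (θ.isOpen_dom s⁻¹).isOpenMap_subtype_val _ h1
  convert h2 using 1
  ext x
  constructor
  · rintro ⟨hx, h⟩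
    exact ⟨⟨x, hx⟩, ⟨θ.map_mem s _, h⟩, rfl⟩
  · rintro ⟨⟨x, hx⟩, ⟨_, h⟩, rfl⟩
    exact ⟨hx, h⟩

theorem continuous_mul :
    Continuous fun p : {p : θ.Germ × θ.Germ // src p.1 = rng p.2} =>
      Germ.mul p.1.1 p.1.2 p.2 := by
  rw [continuous_def]
  intro O hO
  rw [isOpen_iff_mem_nhds]
  rintro ⟨⟨a, b⟩, h⟩ hab
  obtain ⟨s, x, hx, rfl⟩ := exists_germ a
  obtain ⟨t, y, hy, rfl⟩ := exists_germ b
  change Germ.mul _ _ h ∈ O at hab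
  rw [mul_germ s t x y hx hy h] at hab
  have hN : IsOpen (germSet (θ := θ) s Set.univ ×ˢ
      germSet (θ := θ) t {y : X | ∃ hy : y ∈ θ.dom (s * t)⁻¹, germ (s * t) y hy ∈ O}) :=
    (isOpen_germSet s isOpen_univ).prod (isOpen_germSet t (isOpen_iff.1 hO (s * t)))
  refine Filter.mem_of_superset ((hN.preimage continuous_subtype_val).mem_nhds
    ⟨⟨x, hx, trivial, rfl⟩, ⟨y, hy, ⟨_, hab⟩, rfl⟩⟩) ?_
  rintro ⟨⟨_, _⟩, h'⟩ ⟨⟨x', hx', -, rfl⟩, ⟨y', hy', ⟨_, hab'⟩, rfl⟩⟩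
  change Germ.mul _ _ h' ∈ O
  rw [mul_germ s t x' y' hx' hy' h']
  exact hab'

variable (θ)

/-- The groupoid of germs `S ⋉_θ X`. -/
noncomputable def germGroupoid : TopologicalGroupoid θ.Germ X where
  src := src
  rng := rng
  unit := unit
  mul := Germ.mul
  inv := Germ.inv
  src_unit x := rfl
  rng_unit x := by
    obtain ⟨e, he, hx⟩ := exists_idem θ x
    rw [unit_eq he x hx, rng_germ, θ.map_idem he]
  src_mul a b h := by
    obtain ⟨s, x, hx, rfl⟩ := exists_germ a
    obtain ⟨t, y, hy, rfl⟩ := exists_germ b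
    rw [mul_germ s t x y hx hy h]; rfl
  rng_mul a b h := by
    obtain ⟨s, x, hx, rfl⟩ := exists_germ a
    obtain ⟨t, y, hy, rfl⟩ := exists_germ b
    rw [mul_germ s t x y hx hy h, rng_germ, rng_germ]
    obtain rfl : x = θ.map t ⟨y, hy⟩ := h
    exact θ.map_mul s t ⟨y, hy⟩ hx
  src_inv a := by
    obtain ⟨s, x, hx, rfl⟩ := exists_germ a
    rfl
  rng_inv a := by
    obtain ⟨s, x, hx, rfl⟩ := exists_germ a
    exact θ.map_inv_map s ⟨x, hx⟩
  mul_assoc a b c hab hbc := by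
    obtain ⟨s, x, hx, rfl⟩ := exists_germ a
    obtain ⟨t, y, hy, rfl⟩ := exists_germ b
    obtain ⟨r, z, hz, rfl⟩ := exists_germ c
    have e1 := mul_germ s t x y hx hy hab
    have e2 := mul_germ t r y z hy hz hbc
    have hyz : y = θ.map r ⟨z, hz⟩ := hbc
    have hxz : x = θ.map (t * r) ⟨z, θ.mem_mul t r ⟨z, hz⟩ (hyz ▸ hy)⟩ := by
      subst hyz
      exact (show x = _ from hab).trans (θ.map_mul t r ⟨z, hz⟩ hy).symm
    exact (mul_eq _ e1 rfl hyz).trans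
      ((germ_congr (mul_assoc s t r) rfl _ _).trans (mul_eq _ rfl e2 hxz).symm)
  unit_mul a := by
    obtain ⟨s, x, hx, rfl⟩ := exists_germ a
    obtain ⟨e, he, hy⟩ := exists_idem θ (θ.map s ⟨x, hx⟩)
    exact (mul_eq _ (unit_eq he _ hy) rfl rfl).trans (germ_eq_of_natLE (idem_mul_natLE s he) _)
  mul_unit a := by
    obtain ⟨s, x, hx, rfl⟩ := exists_germ a
    obtain ⟨e, he, hy⟩ := exists_idem θ x
    exact (mul_eq _ rfl (unit_eq he _ hy) (θ.map_idem he ⟨x, hy⟩).symm).trans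
      (germ_eq_of_natLE (mul_idem_natLE s he) _)
  inv_mul a := by
    obtain ⟨s, x, hx, rfl⟩ := exists_germ a
    exact (mul_eq _ (inv_germ s x hx) rfl rfl).trans (unit_eq (inv_mul_idem s) _ _).symm
  mul_inv a := by
    obtain ⟨s, x, hx, rfl⟩ := exists_germ a
    exact (mul_eq _ rfl (inv_germ s x hx) (θ.map_inv_map s ⟨x, hx⟩).symm).trans
      (unit_eq (mul_inv_idem s) _ _).symm
  isEmbedding_unit := .of_leftInverse (f := src) (fun _ => rfl) continuous_src continuous_unit
  continuous_mul := continuous_mul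
  continuous_inv := continuous_inv

end TopPartialAction

/-- A zero-dimensional space: the clopen sets form a basis. -/
class IsZeroDimensional (X : Type*) [TopologicalSpace X] : Prop where
  isTopologicalBasis : IsTopologicalBasis {U : Set X | IsClopen U}

/-- The groupoid of germs of a partial action on a locally compact Hausdorff zero-dimensional space
is ample. -/
instance {S X : Type*} [InverseSemigroup S] [TopologicalSpace X] [LocallyCompactSpace X]
    [T2Space X] [IsZeroDimensional X] (θ : TopPartialAction S X) : θ.germGroupoid.IsAmple where
  isLocalHomeomorph_src := TopPartialAction.isLocalHomeomorph_src
  t2Space := inferInstance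
  isTopologicalBasis := by
    refine isTopologicalBasis_of_isOpen_of_nhds (fun U hU => hU.1) fun x O hx hO => ?_
    obtain ⟨K, hK, hKO, hKc⟩ := LocallyCompactSpace.local_compact_nhds x O (hO.mem_nhds hx)
    obtain ⟨C, hC, hxC, hCK⟩ :=
      (IsZeroDimensional.isTopologicalBasis (X := X)).mem_nhds_iff.1 hK
    exact ⟨C, ⟨hC.isOpen, hKc.of_isClosed_subset hC.isClosed hCK⟩, hxC, hCK.trans hKO⟩

/-! ### The algebra of a space and dual partial actions -/

theorem IsLocallyConstant.isClosed_support {R X : Type*} [Zero R] [TopologicalSpace X] {f : X → R}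
    (hf : IsLocallyConstant f) : IsClosed (Function.support f) :=
  ⟨by convert hf {0} using 1; ext x; simp⟩

/-- `A_R(X)`: the `R`-algebra of locally constant functions `X → R` with compact support
`{x | f x ≠ 0}`, under pointwise operations. -/
def SpaceAlgebra (R X : Type*) [CommRing R] [TopologicalSpace X] :
    NonUnitalSubalgebra R (X → R) where
  carrier := {f | IsLocallyConstant f ∧ IsCompact (Function.support f)}
  add_mem' {f g} hf hg :=
    have h : IsLocallyConstant (f + g) := hf.1.add hg.1
    ⟨h, (hf.2.union hg.2).of_isClosed_subset h.isClosed_support (Function.support_add _ _)⟩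
  zero_mem' := ⟨IsLocallyConstant.const 0, by simp⟩
  mul_mem' {f g} hf hg :=
    have h : IsLocallyConstant (f * g) := hf.1.mul hg.1
    ⟨h, hf.2.of_isClosed_subset h.isClosed_support (Function.support_mul_subset_left _ _)⟩
  smul_mem' c f hf :=
    have h : IsLocallyConstant (c • f) := hf.1.comp (c * ·)
    ⟨h, hf.2.of_isClosed_subset h.isClosed_support (Function.support_const_smul_subset c f)⟩

/-- A subset `I` of a ring (in practice an ideal) has local units: every finite subset of `I` has
an idempotent two-sided unit in `I`. -/
def HasLocalUnits {A : Type*} [NonUnitalRing A] (I : Set A) : Prop :=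
  ∀ F : Finset A, (F : Set A) ⊆ I → ∃ e ∈ I, e * e = e ∧ ∀ r ∈ F, e * r = r ∧ r * e = r

/-- A commutative ring is indecomposable if its only idempotents are `0` and `1`. -/
def IsIndecomposableRing (R : Type*) [CommRing R] : Prop :=
  ∀ e : R, e * e = e → e = 0 ∨ e = 1

/-- `α` is the dual partial action of `θ`: the ideal `D_s` consists of the functions supported in
`X_s`, and `α_s(f)` is `f ∘ θ_{s*}` on `X_s`, extended by zero. -/
structure AlgPartialAction.IsDual {S R X : Type*} [InverseSemigroup S] [CommRing R]
    [TopologicalSpace X] (α : AlgPartialAction S R (SpaceAlgebra R X))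
    (θ : TopPartialAction S X) : Prop where
  mem_ideal : ∀ (s : S) (f : SpaceAlgebra R X),
    f ∈ α.ideal s ↔ Function.support (f : X → R) ⊆ θ.dom s
  map_apply : ∀ (s : S) (f : α.ideal s⁻¹) (x : X) (hx : x ∈ θ.dom s⁻¹⁻¹),
    ((α.map s f : SpaceAlgebra R X) : X → R) x =
      ((f : SpaceAlgebra R X) : X → R) (θ.map s⁻¹ ⟨x, hx⟩)
  map_apply_of_notMem : ∀ (s : S) (f : α.ideal s⁻¹) (x : X), x ∉ θ.dom s →
    ((α.map s f : SpaceAlgebra R X) : X → R) x = 0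

/-!
The partial action `θ` is recovered from `α` by Stone duality. Over an indecomposable ring the
idempotents of `A_R(X)` are the characteristic functions `1_K` of compact-open sets, so that an
ideal with local units consists of all functions supported in the open set on which some element of
the ideal does not vanish (`SpaceAlgebra.mem_iff_support_subset_openSupport`). Let `φ` be an
isomorphism between two such ideals, with open sets `U` and `V`. For `y ∈ V` the sets `K ⊆ U` with
`φ 1_K y = 1` form an ultrafilter of compact-open sets, which converges to a point of `U`; hence `φ`
comes from a homeomorphism `U ≃ V` (`SpaceAlgebra.exists_homeomorph`). The homeomorphisms `θ_s`
obtained in this way from the `α_s` are determined by them, and this turns the partial homomorphism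
law for `α` into that for `θ` (`AlgPartialAction.isPartialHom_of_map_apply`). Over the zero ring,
where `A_R(X) = 0` carries no information about `X`, the trivial action on `X` serves as `θ`.

For the second assertion, let `α` be dual to `θ`, over any ring. The map `AlgPartialAction.germMap`
sends `a δ_s` to the function on germs with value `a (r γ)` at the germs `γ` of `s` and zero
elsewhere. It kills the null ideal and turns the product of formal sums into convolution. It is onto
because a compact-open bisection is a finite disjoint union of basic sets `[s, C]`
(`AlgPartialAction.steinbergSubmodule_le_range`).

Injectivity does not need the groupoid to be Hausdorff. Fix `x ∈ X` and a formal sum `∑ a_s δ_s`.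
On a small compact-open neighbourhood `K` of `x` every `a_s` is constant, so that the restriction
of the sum to `K` is `∑ a_s(x) 1_K δ_s`. If `s` and `t` have the same germ with range `x`, then a
common lower bound `u` has it too, and `1_K δ_s` and `1_K δ_t` both agree with `1_K δ_u` modulo the
null ideal. Near `x` the sum therefore depends, modulo the null ideal, only on the values of its
image at the germs with range `x` (`AlgPartialAction.exists_localize_sub_mem_null`). So a formal sum
in the kernel is null near every point, and by compactness it is null.
-/

/-! ### Compact-open sets and locally constant functions -/

theorem IsOpen.exists_compactOpens_mem_subset {X : Type*} [TopologicalSpace X]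
    [LocallyCompactSpace X] [T2Space X] [IsZeroDimensional X] {O : Set X} (hO : IsOpen O) {x : X}
    (hx : x ∈ O) : ∃ K : CompactOpens X, x ∈ K ∧ (K : Set X) ⊆ O := by
  obtain ⟨K, hK, hKO, hKc⟩ := LocallyCompactSpace.local_compact_nhds x O (hO.mem_nhds hx)
  obtain ⟨C, hC, hxC, hCK⟩ :=
    (IsZeroDimensional.isTopologicalBasis (X := X)).mem_nhds_iff.1 hK
  exact ⟨⟨⟨C, hKc.of_isClosed_subset hC.isClosed hCK⟩, hC.isOpen⟩, hxC, hCK.trans hKO⟩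

namespace SpaceAlgebra

variable {R X : Type*} [CommRing R] [TopologicalSpace X]

theorem ext_apply {f g : SpaceAlgebra R X} (h : ∀ x, f.1 x = g.1 x) : f = g :=
  Subtype.ext (funext h)

/-- The support of an element of `A_R(X)`, as a compact-open set. -/
def supp (f : SpaceAlgebra R X) : CompactOpens X :=
  ⟨⟨Function.support f.1, f.2.2⟩, f.2.1 {0}ᶜ⟩

/-- The union of the supports of the elements of a set of functions. -/
def openSupport (I : Set (SpaceAlgebra R X)) : Set X := ⋃ f ∈ I, Function.support f.1

theorem mem_openSupport {I : Set (SpaceAlgebra R X)} {x : X} :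
    x ∈ openSupport I ↔ ∃ f ∈ I, f.1 x ≠ 0 := by
  simp [openSupport]

theorem isOpen_openSupport (I : Set (SpaceAlgebra R X)) : IsOpen (openSupport I) :=
  isOpen_biUnion fun f _ => (supp f).isOpen

variable {I J : Submodule R (SpaceAlgebra R X)} {U V : Set X}

/-- Over an indecomposable ring, an ideal `I` with local units consists of all functions that vanish
outside an open set: an idempotent `e` with `e g = g` takes the value `1` wherever `g` does not
vanish, so that finitely many functions in `I` that together cover a compact set have a common
unit, which is `1` on that set. -/
theorem mem_iff_support_subset_openSupport (hR : IsIndecomposableRing R)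
    (hmul : ∀ a {b}, b ∈ I → b * a ∈ I) (hI : HasLocalUnits (I : Set (SpaceAlgebra R X)))
    (f : SpaceAlgebra R X) :
    f ∈ I ↔ Function.support f.1 ⊆ openSupport (I : Set (SpaceAlgebra R X)) := by
  classical
  refine ⟨fun hf x hx => mem_openSupport.2 ⟨f, hf, hx⟩, fun hf => ?_⟩
  obtain ⟨e, he, h⟩ : ∃ e ∈ I, ∀ x ∈ Function.support f.1, e.1 x = 1 := by
    refine f.2.2.induction_on (p := fun A => ∃ e ∈ I, ∀ x ∈ A, e.1 x = 1)
      ⟨0, I.zero_mem, fun _ h => h.elim⟩ ?_ ?_ ?_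
    · rintro A B hAB ⟨e, he, h⟩; exact ⟨e, he, fun x hx => h x (hAB hx)⟩
    · rintro A B ⟨e, he, h⟩ ⟨e', he', h'⟩
      obtain ⟨u, hu, -, H⟩ := hI {e, e'} (by
        intro a ha
        simp only [Finset.coe_insert, Finset.coe_singleton, Set.mem_insert_iff,
          Set.mem_singleton_iff] at ha
        rcases ha with rfl | rfl
        exacts [he, he'])
      have h1 : u * e = e := (H e (by simp)).1
      have h2 : u * e' = e' := (H e' (by simp)).1
      refine ⟨u, hu, ?_⟩
      rintro x (hx | hx)
      · have : u.1 x * e.1 x = e.1 x := congrFun (congrArg Subtype.val h1) x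
        rwa [h x hx, mul_one] at this
      · have : u.1 x * e'.1 x = e'.1 x := congrFun (congrArg Subtype.val h2) x
        rwa [h' x hx, mul_one] at this
    · intro x hx
      obtain ⟨g, hg, hgx⟩ := mem_openSupport.1 (hf hx)
      obtain ⟨u, hu, huu, H⟩ := hI {g} (by simpa using hg)
      have h1 : u.1 x * g.1 x = g.1 x :=
        congrFun (congrArg Subtype.val (H g (by simp)).1) x
      have h2 : u.1 x * u.1 x = u.1 x := congrFun (congrArg Subtype.val huu) x
      refine ⟨_, mem_nhdsWithin_of_mem_nhds ((u.2.1 {u.1 x}).mem_nhds rfl), u, hu, fun y hy => ?_⟩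
      rw [show u.1 y = u.1 x from hy]
      refine (hR _ h2).resolve_left fun h0 => hgx ?_
      rw [← h1, h0, zero_mul]
  have : e * f = f := by
    refine ext_apply fun x => ?_
    change e.1 x * f.1 x = f.1 x
    by_cases hx : f.1 x = 0
    · rw [hx, mul_zero]
    · rw [h x hx, one_mul]
  rw [← this]
  exact hmul f he

variable [T2Space X]

variable (R) in
/-- The characteristic function of a compact-open set, as an element of `A_R(X)`. -/
noncomputable def ind (K : CompactOpens X) : SpaceAlgebra R X :=
  ⟨(K : Set X).indicator 1, by
    have h : IsLocallyConstant ((K : Set X).indicator (1 : X → R)) := by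
      refine IsLocallyConstant.iff_exists_open _ |>.2 fun x => ?_
      by_cases hx : x ∈ K
      · exact ⟨K, K.isOpen, hx, fun y hy => by
          rw [Set.indicator_of_mem hy, Set.indicator_of_mem (show x ∈ (K : Set X) from hx)]; rfl⟩
      · exact ⟨(K : Set X)ᶜ, K.isCompact.isClosed.isOpen_compl, hx, fun y hy => by
          rw [Set.indicator_of_notMem hy, Set.indicator_of_notMem hx]⟩
    exact ⟨h, K.isCompact.of_isClosed_subset h.isClosed_support Set.support_indicator_subset⟩⟩

theorem ind_of_mem {K : CompactOpens X} {x : X} (hx : x ∈ K) : (ind R K).1 x = 1 :=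
  Set.indicator_of_mem (show x ∈ (K : Set X) from hx) _

theorem ind_of_notMem {K : CompactOpens X} {x : X} (hx : x ∉ K) : (ind R K).1 x = 0 :=
  Set.indicator_of_notMem (show x ∉ (K : Set X) from hx) _

theorem support_ind_subset (K : CompactOpens X) : Function.support (ind R K).1 ⊆ K :=
  Set.support_indicator_subset

theorem ind_bot : ind R (⊥ : CompactOpens X) = 0 :=
  ext_apply fun _ => ind_of_notMem (Set.notMem_empty _)

theorem ind_inf (K L : CompactOpens X) : ind R (K ⊓ L) = ind R K * ind R L := by
  refine ext_apply fun x => ?_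
  change _ = (ind R K).1 x * (ind R L).1 x
  by_cases hK : x ∈ K
  · by_cases hL : x ∈ L
    · rw [ind_of_mem hK, ind_of_mem hL, ind_of_mem (show x ∈ K ⊓ L from ⟨hK, hL⟩), one_mul]
    · rw [ind_of_notMem hL, ind_of_notMem fun h : x ∈ K ⊓ L => hL h.2, mul_zero]
  · rw [ind_of_notMem hK, ind_of_notMem fun h : x ∈ K ⊓ L => hK h.1, zero_mul]

theorem ind_mul_self (K : CompactOpens X) : ind R K * ind R K = ind R K := by
  rw [← ind_inf, inf_idem]

theorem ind_mul_ind_of_le {K L : CompactOpens X} (h : K ≤ L) : ind R K * ind R L = ind R K := by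
  rw [← ind_inf, inf_eq_left.2 h]

theorem ind_sdiff (K L : CompactOpens X) : ind R (K \ L) = ind R K - ind R K * ind R L := by
  refine ext_apply fun x => ?_
  change _ = (ind R K).1 x - (ind R K).1 x * (ind R L).1 x
  by_cases hK : x ∈ K
  · by_cases hL : x ∈ L
    · rw [ind_of_mem hK, ind_of_mem hL, ind_of_notMem fun h : x ∈ K \ L => h.2 hL, mul_one,
        sub_self]
    · rw [ind_of_mem hK, ind_of_notMem hL, ind_of_mem (show x ∈ K \ L from ⟨hK, hL⟩), mul_zero,
        sub_zero]
  · rw [ind_of_notMem hK, ind_of_notMem fun h : x ∈ K \ L => hK h.1, zero_mul, sub_zero]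

theorem ind_sup (K L : CompactOpens X) :
    ind R (K ⊔ L) = ind R K + ind R L - ind R K * ind R L := by
  refine ext_apply fun x => ?_
  change _ = (ind R K).1 x + (ind R L).1 x - (ind R K).1 x * (ind R L).1 x
  by_cases hK : x ∈ K
  · rw [ind_of_mem hK, ind_of_mem (show x ∈ K ⊔ L from Or.inl hK)]; ring
  · by_cases hL : x ∈ L
    · rw [ind_of_notMem hK, ind_of_mem hL, ind_of_mem (show x ∈ K ⊔ L from Or.inr hL)]; ring
    · rw [ind_of_notMem hK, ind_of_notMem hL,
        ind_of_notMem (show x ∉ K ⊔ L from fun h => h.elim hK hL)]; ring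

theorem ind_mul_of_support_subset {f : SpaceAlgebra R X} {K : CompactOpens X}
    (h : Function.support f.1 ⊆ K) : ind R K * f = f := by
  refine ext_apply fun x => ?_
  change (ind R K).1 x * f.1 x = f.1 x
  by_cases hx : x ∈ K
  · rw [ind_of_mem hx, one_mul]
  · rw [Function.notMem_support.1 fun h' => hx (h h'), mul_zero]

theorem ind_mem (hI : ∀ f, f ∈ I ↔ Function.support f.1 ⊆ U) {K : CompactOpens X}
    (hK : (K : Set X) ⊆ U) : ind R K ∈ I :=
  (hI _).2 ((support_ind_subset K).trans hK)

variable [LocallyCompactSpace X] [IsZeroDimensional X]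

/-- An element of `A_R(X)` is constant on small compact-open neighbourhoods of each point. -/
theorem exists_ind_mul_eq_smul (f : SpaceAlgebra R X) {O : Set X} (hO : IsOpen O) {x : X}
    (hx : x ∈ O) : ∃ K : CompactOpens X, x ∈ K ∧ (K : Set X) ⊆ O ∧
      ∀ L ≤ K, ind R L * f = f.1 x • ind R L := by
  obtain ⟨K, hxK, hK⟩ := (hO.inter (f.2.1 {f.1 x})).exists_compactOpens_mem_subset ⟨hx, rfl⟩
  refine ⟨K, hxK, fun y hy => (hK hy).1, fun L hL => ext_apply fun y => ?_⟩
  change (ind R L).1 y * f.1 y = f.1 x * (ind R L).1 y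
  by_cases hy : y ∈ L
  · rw [mul_comm, show f.1 y = f.1 x from (hK (hL hy)).2]
  · rw [ind_of_notMem hy, zero_mul, mul_zero]

/-- The functions supported in an open set `O` are spanned by the characteristic functions of
compact-open subsets of `O`, in the form of an induction principle. -/
theorem induction_ind (O : Set X) (hO : IsOpen O) {p : SpaceAlgebra R X → Prop}
    (h0 : p 0) (hadd : ∀ f g, p f → p g → p (f + g))
    (hind : ∀ (c : R) (K : CompactOpens X), (K : Set X) ⊆ O → p (c • ind R K))
    (f : SpaceAlgebra R X) (hf : Function.support f.1 ⊆ O) : p f := by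
  suffices H : ∃ C : CompactOpens X, (supp f : Set X) ⊆ C ∧ (C : Set X) ⊆ O ∧
      ∀ L ≤ C, p (ind R L * f) by
    obtain ⟨C, hC, -, h⟩ := H
    rw [← ind_mul_of_support_subset hC]; exact h C le_rfl
  refine (supp f).isCompact.induction_on (p := fun A => ∃ C : CompactOpens X, A ⊆ C ∧
    (C : Set X) ⊆ O ∧ ∀ L ≤ C, p (ind R L * f)) ?_ ?_ ?_ ?_
  · refine ⟨⊥, le_rfl, Set.empty_subset _, fun L hL => ?_⟩
    rw [le_bot_iff.1 hL, ind_bot, zero_mul]; exact h0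
  · rintro A B hAB ⟨C, hC, h⟩; exact ⟨C, hAB.trans hC, h⟩
  · rintro A B ⟨C, hC, hCO, h⟩ ⟨C', hC', hCO', h'⟩
    refine ⟨C ⊔ C', Set.union_subset_union hC hC', Set.union_subset hCO hCO', fun L hL => ?_⟩
    have : ind R L * f = ind R (L ⊓ C) * f + ind R (L \ C) * f := by
      rw [ind_inf, ind_sdiff, ← add_mul]; congr 1; abel
    rw [this]
    refine hadd _ _ (h _ inf_le_right) (h' _ ?_)
    rintro x ⟨hx, hxC⟩
    exact (hL hx).resolve_left hxC
  · intro x hx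
    obtain ⟨K, hxK, hKO, hK⟩ := exists_ind_mul_eq_smul f hO (hf hx)
    exact ⟨K, mem_nhdsWithin_of_mem_nhds (K.isOpen.mem_nhds hxK), K, le_rfl, hKO, fun L hL =>
      hK L hL ▸ hind _ _ ((show (L : Set X) ⊆ K from hL).trans hKO)⟩

/-! ### Isomorphisms between ideals -/

/-- The functions supported in an open set `U` separate the points of `U` from all other points. -/
theorem eq_of_forall_apply_eq [Nontrivial R] (hU : IsOpen U)
    (hI : ∀ f, f ∈ I ↔ Function.support f.1 ⊆ U) {x y : X} (hx : x ∈ U)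
    (h : ∀ f ∈ I, f.1 x = f.1 y) : x = y := by
  by_contra hxy
  obtain ⟨K, hxK, hK⟩ :=
    (hU.inter isOpen_compl_singleton).exists_compactOpens_mem_subset (x := x) ⟨hx, hxy⟩
  have := h _ (ind_mem hI fun z hz => (hK hz).1)
  rw [ind_of_mem hxK, ind_of_notMem fun hy => (hK hy).2 rfl] at this
  exact one_ne_zero this

/-- Let `φ` be an isomorphism from the functions supported in `U` to those supported in `V`. Every
character `f ↦ φ f y` with `y ∈ V` is evaluation at a point of `U`: the compact-open sets `K` with
`φ 1_K y = 1` form an ultrafilter of compact-open subsets of `U`, and `φ f y = f x` for the unique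
point `x` that they have in common. -/
theorem exists_apply_eq (hR : IsIndecomposableRing R) [Nontrivial R] (hV : IsOpen V)
    (hU : IsOpen U)
    (hI : ∀ f, f ∈ I ↔ Function.support f.1 ⊆ U) (hJ : ∀ f, f ∈ J ↔ Function.support f.1 ⊆ V)
    (φ : I ≃ₗ[R] J)
    (hφ : ∀ a b c : I, (c : SpaceAlgebra R X) = a * b → (φ c : SpaceAlgebra R X) = φ a * φ b)
    {y : X} (hy : y ∈ V) : ∃ x ∈ U, ∀ f : I, (φ f).1.1 y = f.1.1 x := by
  have hφ' : ∀ a b c : I, (c : SpaceAlgebra R X) = a * b →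
      (φ c).1.1 y = (φ a).1.1 y * (φ b).1.1 y := fun a b c h =>
    congrFun (congrArg Subtype.val (hφ a b c h)) y
  let F : Set (CompactOpens X) := {K | ∃ h : ind R K ∈ I, (φ ⟨ind R K, h⟩).1.1 y = 1}
  obtain ⟨K₀, hK₀, hK₀y⟩ : F.Nonempty := by
    obtain ⟨L, hyL, hL⟩ := hV.exists_compactOpens_mem_subset hy
    let f := φ.symm ⟨ind R L, ind_mem hJ hL⟩
    have hK : (supp f.1 : Set X) ⊆ U := (hI _).1 f.2
    refine ⟨supp f.1, ind_mem hI hK, ?_⟩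
    have h := hφ' ⟨_, ind_mem hI hK⟩ f f (ind_mul_of_support_subset subset_rfl).symm
    have hf : (φ f).1.1 y = 1 := by
      rw [show φ f = _ from φ.apply_symm_apply _]; exact ind_of_mem hyL
    rw [hf, mul_one] at h
    exact h.symm
  have hinf : ∀ K ∈ F, ∀ L ∈ F, K ⊓ L ∈ F := by
    rintro K ⟨hK, hKy⟩ L ⟨hL, hLy⟩
    have h : ind R (K ⊓ L) ∈ I := by
      rw [hI] at hK ⊢
      refine Set.Subset.trans (fun x hx => ?_) hK
      rw [ind_inf] at hx
      exact left_ne_zero_of_mul (show (ind R K).1 x * (ind R L).1 x ≠ 0 from hx)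
    exact ⟨h, by rw [hφ' ⟨_, hK⟩ ⟨_, hL⟩ ⟨_, h⟩ (ind_inf K L), hKy, hLy, one_mul]⟩
  obtain ⟨x, hx⟩ : (⋂ K : F, ((K : CompactOpens X) : Set X)).Nonempty := by
    have : Nonempty F := ⟨⟨K₀, hK₀, hK₀y⟩⟩
    refine IsCompact.nonempty_iInter_of_directed_nonempty_isCompact_isClosed _ ?_ ?_
      (fun K => K.1.isCompact) (fun K => K.1.isCompact.isClosed)
    · intro K L
      exact ⟨⟨K.1 ⊓ L.1, hinf _ K.2 _ L.2⟩, Set.inter_subset_left, Set.inter_subset_right⟩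
    · rintro ⟨K, hK, hKy⟩
      by_contra hne
      obtain rfl : K = ⊥ := SetLike.coe_injective (Set.not_nonempty_iff_eq_empty.1 hne)
      rw [show (⟨ind R ⊥, hK⟩ : I) = 0 from Subtype.ext ind_bot, φ.map_zero] at hKy
      exact zero_ne_one hKy
  rw [Set.mem_iInter] at hx
  have hxK : ∀ K ∈ F, x ∈ K := fun K hK => hx ⟨K, hK⟩
  have hxU : x ∈ U := (hI _).1 hK₀ (by
    rw [Function.mem_support, ind_of_mem (hxK _ ⟨hK₀, hK₀y⟩)]; exact one_ne_zero)
  refine ⟨x, hxU, fun f => ?_⟩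
  obtain ⟨K, hxK', hKU, hK⟩ :=
    exists_ind_mul_eq_smul f.1 (hU.inter K₀.isOpen) ⟨hxU, hxK _ ⟨hK₀, hK₀y⟩⟩
  have hKI : ind R K ∈ I := ind_mem hI fun z hz => (hKU hz).1
  have hval : (φ ⟨_, hKI⟩).1.1 y = 1 := by
    refine (hR _ (hφ' _ _ ⟨_, hKI⟩ (ind_mul_self K).symm).symm).resolve_left fun h0 => ?_
    -- otherwise `K₀ \ K` belongs to the ultrafilter, although `x` is not in it
    have hd : ind R (K₀ \ K) = ind R K₀ - ind R K := by
      rw [ind_sdiff, mul_comm, ind_mul_ind_of_le fun z hz => (hKU hz).2]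
    have hdI : ind R (K₀ \ K) ∈ I := hd ▸ I.sub_mem hK₀ hKI
    refine (hxK (K₀ \ K) ⟨hdI, ?_⟩).2 hxK'
    have h1 : (⟨_, hK₀⟩ : I) = ⟨_, hdI⟩ + ⟨_, hKI⟩ :=
      Subtype.ext (sub_eq_iff_eq_add.1 hd.symm)
    rw [h1, φ.map_add] at hK₀y
    change (φ _).1.1 y + (φ _).1.1 y = 1 at hK₀y
    rwa [h0, add_zero] at hK₀y
  have h := hφ' ⟨_, hKI⟩ f (f.1.1 x • ⟨_, hKI⟩) (hK K le_rfl).symm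
  rw [map_smul, hval, one_mul] at h
  rw [← h]
  change f.1.1 x * (φ _).1.1 y = _
  rw [hval, mul_one]

/-- A map into an open set `V` is continuous if its composites with the functions supported in `V`
are locally constant. -/
theorem continuous_of_forall_exists [Nontrivial R] (hV : IsOpen V)
    (hJ : ∀ f, f ∈ J ↔ Function.support f.1 ⊆ V) {p : U → V}
    (hp : ∀ g ∈ J, ∃ f : SpaceAlgebra R X, ∀ x, g.1 (p x) = f.1 x) : Continuous p := by
  rw [continuous_iff_continuousAt]
  intro x O hO
  obtain ⟨O', hO', hO'O⟩ := mem_nhds_subtype V _ _ |>.1 hO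
  obtain ⟨O'', hO''O', hO'', hx⟩ := mem_nhds_iff.1 hO'
  obtain ⟨K, hxK, hK⟩ := (hV.inter hO'').exists_compactOpens_mem_subset ⟨(p x).2, hx⟩
  obtain ⟨f, hf⟩ := hp _ (ind_mem hJ fun z hz => (hK hz).1)
  have hN : Subtype.val ⁻¹' (f.1 ⁻¹' {f.1 x}) ∈ 𝓝 x :=
    ((f.2.1 _).preimage continuous_subtype_val).mem_nhds rfl
  refine Filter.mem_map.2 <| Filter.mem_of_superset hN fun z hz => hO'O (hO''O' (hK ?_).2)
  by_contra hzK
  have h := hf z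
  rw [ind_of_notMem hzK, show f.1 z = f.1 x from hz, ← hf x, ind_of_mem hxK] at h
  exact zero_ne_one h

/-- Isomorphisms between ideals of functions supported in open sets come from homeomorphisms. -/
theorem exists_homeomorph (hR : IsIndecomposableRing R) [Nontrivial R] (hU : IsOpen U)
    (hV : IsOpen V)
    (hI : ∀ f, f ∈ I ↔ Function.support f.1 ⊆ U) (hJ : ∀ f, f ∈ J ↔ Function.support f.1 ⊆ V)
    (φ : I ≃ₗ[R] J)
    (hφ : ∀ a b c : I, (c : SpaceAlgebra R X) = a * b → (φ c : SpaceAlgebra R X) = φ a * φ b) :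
    ∃ h : U ≃ₜ V, ∀ (f : I) (x : U), (φ f).1.1 (h x) = f.1.1 x := by
  have hψ : ∀ a b c : J, (c : SpaceAlgebra R X) = a * b →
      (φ.symm c : SpaceAlgebra R X) = φ.symm a * φ.symm b := by
    intro a b c h
    have hm : ((φ.symm a : SpaceAlgebra R X) * φ.symm b) ∈ I := by
      rw [hI]
      exact (Function.support_mul_subset_left _ _).trans ((hI _).1 (φ.symm a).2)
    have h2 := hφ (φ.symm a) (φ.symm b) ⟨_, hm⟩ rfl
    rw [φ.apply_symm_apply, φ.apply_symm_apply, ← h] at h2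
    rw [← Subtype.ext h2, φ.symm_apply_apply]
  choose p hpV hp using fun x : U => exists_apply_eq hR hU hV hJ hI φ.symm hψ x.2
  choose q hqU hq using fun y : V => exists_apply_eq hR hV hU hI hJ φ hφ y.2
  have hp' : ∀ (f : I) (x : U), (φ f).1.1 (p x) = f.1.1 x := fun f x => by
    rw [← hp x, φ.symm_apply_apply]
  refine ⟨⟨⟨fun x => ⟨p x, hpV x⟩, fun y => ⟨q y, hqU y⟩, fun x => Subtype.ext ?_,
    fun y => Subtype.ext ?_⟩, ?_, ?_⟩, fun f x => hp' f x⟩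
  · refine (eq_of_forall_apply_eq hU hI x.2 fun f hf => ?_).symm
    rw [← hp' ⟨f, hf⟩ x]
    exact hq ⟨p x, hpV x⟩ ⟨f, hf⟩
  · refine (eq_of_forall_apply_eq hV hJ y.2 fun g hg => ?_).symm
    rw [← hp ⟨q y, hqU y⟩ ⟨g, hg⟩, ← hq y, φ.apply_symm_apply]
  · exact continuous_of_forall_exists hV hJ fun g hg => ⟨_, fun x => (hp x ⟨g, hg⟩).symm⟩
  · exact continuous_of_forall_exists hU hI fun f hf => ⟨_, fun y => (hq y ⟨f, hf⟩).symm⟩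

end SpaceAlgebra

/-! ### The topological partial action -/

namespace AlgPartialAction

open SpaceAlgebra

section

variable {S R A : Type*} [InverseSemigroup S] [CommRing R] [NonUnitalRing A]
  [Module R A] [IsScalarTower R A A] [SMulCommClass R A A] (α : AlgPartialAction S R A)

theorem map_inv_map (s : S) (f : α.ideal s⁻¹) :
    ∃ h : (α.map s f : A) ∈ α.ideal s⁻¹⁻¹, (α.map s⁻¹ ⟨α.map s f, h⟩ : A) = f :=
  α.isPartialHom.inv s f

theorem map_comp (s t : S) (f : α.ideal t⁻¹) (hf : (α.map t f : A) ∈ α.ideal s⁻¹) :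
    ∃ h : (f : A) ∈ α.ideal (s * t)⁻¹,
      (α.map (s * t) ⟨f, h⟩ : A) = α.map s ⟨α.map t f, hf⟩ :=
  α.isPartialHom.mul s t f hf

theorem map_of_natLE {s t : S} (h : s ≼ t) (f : α.ideal s⁻¹) :
    ∃ h : (f : A) ∈ α.ideal t⁻¹, (α.map t ⟨f, h⟩ : A) = α.map s f :=
  α.isPartialHom.mono s t h f

theorem map_mul' (s : S) (a b c : α.ideal s⁻¹) (h : (c : A) = a * b) :
    (α.map s c : A) = α.map s a * α.map s b := by
  rw [← α.map_mul s a b]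
  exact congrArg (fun z => (α.map s z : A)) (Subtype.ext h)

end

/-- Over the zero ring every partial action is dual to the trivial one. -/
theorem exists_isDual_of_subsingleton {S X R : Type*} [InverseSemigroup S] [Nonempty S]
    [TopologicalSpace X] [CommRing R] [Subsingleton R]
    (α : AlgPartialAction S R (SpaceAlgebra R X)) :
    ∃ θ : TopPartialAction S X, α.IsDual θ := by
  obtain ⟨s₀⟩ := ‹Nonempty S›
  have h0 : ∀ (f : SpaceAlgebra R X) (x : X), f.1 x = 0 := fun _ _ => Subsingleton.elim _ _
  refine ⟨⟨fun _ => Set.univ, fun _ => isOpen_univ, fun _ => Homeomorph.refl _,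
    ⟨fun _ _ => ⟨trivial, rfl⟩, fun _ _ _ _ => ⟨trivial, rfl⟩, fun _ _ _ _ => ⟨trivial, rfl⟩⟩,
    Set.eq_univ_of_forall fun x =>
      Set.mem_iUnion₂.2 ⟨s₀⁻¹ * s₀, inv_mul_idem s₀, trivial⟩⟩, fun s f => ?_,
    fun _ _ _ _ => Subsingleton.elim _ _, fun _ _ _ _ => Subsingleton.elim _ _⟩
  have : f = 0 := ext_apply fun x => h0 f x
  exact ⟨fun _ => Set.subset_univ _, fun _ => this ▸ zero_mem _⟩

variable {S X R : Type*} [InverseSemigroup S] [TopologicalSpace X] [LocallyCompactSpace X]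
  [T2Space X] [IsZeroDimensional X] [CommRing R] {α : AlgPartialAction S R (SpaceAlgebra R X)}
  {U : S → Set X}

/-- The point `θ_s x` is determined by the character `α_s f ↦ f x` of `D_s`: here `y = θ_s x` lies in
`X_s`, while `z` may be any point. -/
theorem eq_of_forall_map_apply [Nontrivial R] (hU : ∀ s, IsOpen (U s))
    (hI : ∀ s f, f ∈ α.ideal s ↔ Function.support f.1 ⊆ U s) {s : S} {x y z : X} (hy : y ∈ U s)
    (hxy : ∀ f : α.ideal s⁻¹, (α.map s f).1.1 y = f.1.1 x)
    (hxz : ∀ f : α.ideal s⁻¹, (α.map s f).1.1 z = f.1.1 x) : z = y := by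
  refine (eq_of_forall_apply_eq (hU s) (hI s) hy fun g hg => ?_).symm
  have h1 := hxy ((α.map s).symm ⟨g, hg⟩)
  have h2 := hxz ((α.map s).symm ⟨g, hg⟩)
  rw [LinearEquiv.apply_symm_apply] at h1 h2
  exact h1.trans h2.symm

/-- Homeomorphisms `θ_s` that induce the isomorphisms `α_s` inherit from them the laws of a partial
homomorphism. -/
theorem isPartialHom_of_map_apply [Nontrivial R] (hU : ∀ s, IsOpen (U s))
    (hI : ∀ s f, f ∈ α.ideal s ↔ Function.support f.1 ⊆ U s) (θ : ∀ s, U s⁻¹ ≃ U s)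
    (hθ : ∀ s (f : α.ideal s⁻¹) (x : U s⁻¹), (α.map s f).1.1 (θ s x) = f.1.1 x) :
    IsPartialHom U θ where
  inv s x := by
    have hx : (θ s x : X) ∈ U s⁻¹⁻¹ := by rw [inv_inv']; exact (θ s x).2
    refine ⟨hx, (eq_of_forall_map_apply hU hI (Subtype.prop _) (fun f => hθ s⁻¹ f ⟨_, hx⟩)
      fun f => ?_).symm⟩
    have hf : f.1 ∈ α.ideal s := by rw [← α.inv_ideal_eq]; exact f.2
    obtain ⟨h, e⟩ := α.map_inv_map s ((α.map s).symm ⟨f.1, hf⟩)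
    have h1 := hθ s ((α.map s).symm ⟨f.1, hf⟩) x
    rw [LinearEquiv.apply_symm_apply] at h1
    rw [h1, ← e]
    exact congrArg (fun z => (α.map s⁻¹ z).1.1 x) (Subtype.ext (by simp))
  mul s t x hx := by
    set w : X := (θ t x).1
    obtain ⟨K, hwK, hK⟩ :=
      ((hU s⁻¹).inter (hU t)).exists_compactOpens_mem_subset ⟨hx, (θ t x).2⟩
    have hKs : ind R K ∈ α.ideal s⁻¹ := ind_mem (hI _) fun z hz => (hK hz).1
    have hKt : ind R K ∈ α.ideal t := ind_mem (hI _) fun z hz => (hK hz).2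
    -- every `k ∈ D_{s*}` supported in `K` is `α_t f` for some `f ∈ D_{(st)*}`
    have key : ∀ k (hks : k ∈ α.ideal s⁻¹), k ∈ α.ideal t → ∃ f, ∃ h : f ∈ α.ideal (s * t)⁻¹,
        f.1 x = k.1 w ∧ α.map (s * t) ⟨f, h⟩ = (α.map s ⟨k, hks⟩).1 := by
      intro k hks hkt
      have e1 : α.map t ((α.map t).symm ⟨k, hkt⟩) = ⟨k, hkt⟩ := LinearEquiv.apply_symm_apply _ _
      obtain ⟨h, e⟩ := α.map_comp s t ((α.map t).symm ⟨k, hkt⟩) (by rw [e1]; exact hks)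
      refine ⟨_, h, ?_, e.trans ?_⟩
      · rw [← hθ t _ x, e1]
      · exact congrArg (fun z => (α.map s z).1) (Subtype.ext
          (show (α.map t _ : SpaceAlgebra R X) = k from congrArg Subtype.val e1))
    have hxU : (x : X) ∈ U (s * t)⁻¹ := by
      obtain ⟨f, h, e, -⟩ := key _ hKs hKt
      rw [ind_of_mem hwK] at e
      exact (hI _ f).1 h (by rw [Function.mem_support, e]; exact one_ne_zero)
    have key' : ∀ k (hks : k ∈ α.ideal s⁻¹), k ∈ α.ideal t →
        (α.map s ⟨k, hks⟩).1.1 (θ (s * t) ⟨x, hxU⟩) = k.1 w := by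
      intro k hks hkt
      obtain ⟨f, h, e, e'⟩ := key k hks hkt
      rw [← e', hθ, e]
    refine ⟨hxU, eq_of_forall_map_apply hU hI (Subtype.prop _) (fun f => hθ s f ⟨w, hx⟩)
      fun f => ?_⟩
    have h1 := key' _ (α.mul_mem_right s⁻¹ f.1 hKs) (α.mul_mem_right t f.1 hKt)
    rw [α.map_mul' s ⟨_, hKs⟩ f _ rfl] at h1
    change (α.map s ⟨_, hKs⟩).1.1 _ * _ = (ind R K).1 w * f.1.1 w at h1
    rwa [key' _ hKs hKt, ind_of_mem hwK, one_mul, one_mul] at h1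
  mono s t h x := by
    have hx : (x : X) ∈ U t⁻¹ := by
      have hle := α.ideal_mono (natLE_inv h)
      obtain ⟨K, hxK, hK⟩ := (hU s⁻¹).exists_compactOpens_mem_subset x.2
      exact (hI _ _).1 (hle (ind_mem (hI s⁻¹) hK)) (by
        rw [Function.mem_support, ind_of_mem hxK]; exact one_ne_zero)
    refine ⟨hx, eq_of_forall_map_apply hU hI (Subtype.prop _) (fun f => hθ s f x) fun f => ?_⟩
    obtain ⟨h', e⟩ := α.map_of_natLE h f
    rw [← e, hθ]

theorem iUnion_idem_eq_univ [Nontrivial R]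
    (hI : ∀ s f, f ∈ α.ideal s ↔ Function.support f.1 ⊆ U s) :
    ⋃ e ∈ {e : S | e * e = e}, U e = Set.univ := by
  refine Set.eq_univ_of_forall fun x => ?_
  by_contra hx
  obtain ⟨K, hxK, -⟩ := isOpen_univ.exists_compactOpens_mem_subset (Set.mem_univ x)
  suffices H : ∀ f ∈ Submodule.span R
      (⋃ e ∈ {e : S | e * e = e}, (α.ideal e : Set (SpaceAlgebra R X))), f.1 x = 0 by
    have h := H (ind R K) (by rw [α.nondegenerate]; trivial)
    rw [ind_of_mem hxK] at h
    exact one_ne_zero h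
  intro f h
  induction h using Submodule.span_induction with
  | mem f hf =>
    obtain ⟨e, he, hf⟩ := Set.mem_iUnion₂.1 hf
    by_contra hfx
    exact hx (Set.mem_iUnion₂.2 ⟨e, he, (hI e f).1 hf hfx⟩)
  | zero => rfl
  | add f g _ _ hf hg =>
    change f.1 x + g.1 x = 0
    rw [hf, hg, add_zero]
  | smul c f _ hf =>
    change c * f.1 x = 0
    rw [hf, mul_zero]

theorem exists_isDual [Nontrivial R] (hR : IsIndecomposableRing R)
    (hα : ∀ s, HasLocalUnits (α.ideal s : Set (SpaceAlgebra R X))) :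
    ∃ θ : TopPartialAction S X, α.IsDual θ := by
  let U : S → Set X := fun s => openSupport (α.ideal s : Set (SpaceAlgebra R X))
  have hU : ∀ s, IsOpen (U s) := fun s => isOpen_openSupport _
  have hI : ∀ s f, f ∈ α.ideal s ↔ Function.support f.1 ⊆ U s := fun s =>
    mem_iff_support_subset_openSupport hR (fun a _ hb => α.mul_mem_right s a hb) (hα s)
  choose θ hθ using fun s =>
    exists_homeomorph hR (hU s⁻¹) (hU s) (hI s⁻¹) (hI s) (α.map s) (α.map_mul' s)
  have H := isPartialHom_of_map_apply hU hI (fun s => (θ s).toEquiv) hθ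
  refine ⟨⟨U, hU, θ, H, iUnion_idem_eq_univ hI⟩, hI, fun s f x hx => ?_, fun s f x hx => ?_⟩
  · have hx' : x ∈ U s := by rwa [inv_inv'] at hx
    obtain ⟨y, hy⟩ := (θ s).surjective ⟨x, hx'⟩
    obtain ⟨h, e⟩ := H.inv s y
    have e2 : (θ s⁻¹ ⟨x, hx⟩ : X) = y := by
      rw [← e]
      exact congrArg (fun z => (θ s⁻¹ z : X)) (Subtype.ext (congrArg Subtype.val hy).symm)
    rw [e2, ← hθ s f y, hy]
  · exact Function.notMem_support.1 fun h => hx ((hI s _).1 (α.map s f).2 h)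

end AlgPartialAction

/-! ### Functions on the groupoid of germs -/

/-- A homeomorphism between open subsets matches their compact-open subsets. -/
theorem Homeomorph.exists_compactOpens {X : Type*} [TopologicalSpace X] {U V : Set X}
    (hV : IsOpen V) (h : U ≃ₜ V) {K : CompactOpens X} (hK : (K : Set X) ⊆ U) :
    ∃ L : CompactOpens X, (L : Set X) ⊆ V ∧ ∀ x : U, (h x : X) ∈ L ↔ (x : X) ∈ K := by
  have hc : IsCompact (Subtype.val ⁻¹' (K : Set X) : Set U) :=
    IsInducing.subtypeVal.isCompact_preimage' K.isCompact (by simpa using hK)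
  have ho : IsOpen (Subtype.val ⁻¹' (K : Set X) : Set U) :=
    K.isOpen.preimage continuous_subtype_val
  refine ⟨⟨⟨Subtype.val '' (h '' (Subtype.val ⁻¹' (K : Set X))),
    (hc.image h.continuous).image continuous_subtype_val⟩,
    hV.isOpenMap_subtype_val _ (h.isOpenMap _ ho)⟩, ?_, fun x => ⟨?_, fun hx => ?_⟩⟩
  · rintro _ ⟨y, -, rfl⟩; exact y.2
  · rintro ⟨_, ⟨z, hz, rfl⟩, e⟩
    obtain rfl : z = x := h.injective (Subtype.ext e)
    exact hz
  · exact ⟨_, ⟨x, hx, rfl⟩, rfl⟩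

namespace TopPartialAction

open TopPartialAction.Germ SpaceAlgebra

variable {S X : Type*} [InverseSemigroup S] [TopologicalSpace X] {θ : TopPartialAction S X}

theorem germ_mem_germSet {s : S} {x : X} (hx : x ∈ θ.dom s⁻¹) {U : Set X} (hU : x ∈ U) :
    germ s x hx ∈ germSet s U :=
  ⟨x, hx, hU, rfl⟩

theorem rng_mem_dom {s : S} {a : θ.Germ} (ha : a ∈ germSet s Set.univ) : rng a ∈ θ.dom s := by
  obtain ⟨x, hx, -, rfl⟩ := ha
  exact (θ.map s ⟨x, hx⟩).2

/-- A germ of `s` is determined by its range. -/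
theorem eq_of_rng_eq {s : S} {a b : θ.Germ} (ha : a ∈ germSet s Set.univ)
    (hb : b ∈ germSet s Set.univ) (h : rng a = rng b) : a = b := by
  obtain ⟨x, hx, -, rfl⟩ := ha
  obtain ⟨y, hy, -, rfl⟩ := hb
  exact germ_congr rfl (congrArg Subtype.val ((θ.map s).injective (Subtype.ext h))) hx hy

variable (θ) in
/-- The germ of `s` with range `z ∈ X_s`. -/
def germTo (s : S) (z : X) (hz : z ∈ θ.dom s) : θ.Germ :=
  germ s ((θ.map s).symm ⟨z, hz⟩) (Subtype.prop _)

theorem germTo_mem (s : S) (z : X) (hz : z ∈ θ.dom s) :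
    θ.germTo s z hz ∈ germSet s Set.univ :=
  germ_mem_germSet _ trivial

@[simp] theorem rng_germTo (s : S) (z : X) (hz : z ∈ θ.dom s) : rng (θ.germTo s z hz) = z :=
  congrArg Subtype.val ((θ.map s).apply_symm_apply ⟨z, hz⟩)

theorem germSet_subset_of_natLE {r s : S} (h : r ≼ s) {U : Set X} :
    germSet (θ := θ) r U ⊆ germSet s U := by
  rintro _ ⟨x, hx, hU, rfl⟩
  rw [germ_eq_of_natLE h]
  exact germ_mem_germSet _ hU

/-- If `r ≤ s`, then a germ of `s` with range in `X_r` is a germ of `r`. -/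
theorem mem_germSet_of_natLE {r s : S} (h : r ≼ s) {a : θ.Germ} (ha : a ∈ germSet s Set.univ)
    (har : rng a ∈ θ.dom r) : a ∈ germSet r Set.univ := by
  have h1 := germTo_mem r _ har
  rwa [← eq_of_rng_eq (germSet_subset_of_natLE h h1) ha (rng_germTo _ _ _)]

theorem continuous_germ (s : S) : Continuous fun x : θ.dom s⁻¹ => germ s x.1 x.2 := by
  rw [continuous_def]
  intro O hO
  convert (isOpen_iff.1 hO s).preimage continuous_subtype_val using 1
  ext x
  exact ⟨fun h => ⟨x.2, h⟩, fun ⟨_, h⟩ => h⟩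

theorem isCompactOpenBisection_germSet (s : S) (K : CompactOpens X)
    (hK : (K : Set X) ⊆ θ.dom s⁻¹) :
    θ.germGroupoid.IsCompactOpenBisection (germSet s (K : Set X)) where
  isCompact := by
    have hc : IsCompact (Subtype.val ⁻¹' (K : Set X) : Set (θ.dom s⁻¹)) :=
      IsInducing.subtypeVal.isCompact_preimage' K.isCompact (by simpa using hK)
    convert hc.image (continuous_germ s) using 1
    ext a
    constructor
    · rintro ⟨x, hx, hxK, rfl⟩; exact ⟨⟨x, hx⟩, hxK, rfl⟩
    · rintro ⟨x, hxK, rfl⟩; exact ⟨x, x.2, hxK, rfl⟩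
  isOpen := isOpen_germSet s K.isOpen
  injOn_src := by
    rintro _ ⟨x, hx, -, rfl⟩ _ ⟨y, hy, -, rfl⟩ h
    exact germ_congr rfl h hx hy
  injOn_rng := by
    rintro _ ⟨x, hx, -, rfl⟩ _ ⟨y, hy, -, rfl⟩ h
    exact eq_of_rng_eq (germ_mem_germSet hx trivial) (germ_mem_germSet hy trivial) h

variable {R : Type*} [CommRing R]

/-- The function on germs corresponding to `f δ_s`: its value at a germ of `s` is the value of `f`
at the range, and it vanishes on all other arrows. -/
noncomputable def germFun (s : S) : (X → R) →ₗ[R] (θ.Germ → R) where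
  toFun f := (germSet s Set.univ).indicator (f ∘ rng)
  map_add' f g := Set.indicator_add _ (f ∘ rng) (g ∘ rng)
  map_smul' c f := Set.indicator_const_smul _ c (f ∘ rng)

theorem germFun_of_mem {s : S} (f : X → R) {a : θ.Germ} (ha : a ∈ germSet s Set.univ) :
    germFun s f a = f (rng a) :=
  Set.indicator_of_mem ha _

theorem germFun_of_notMem {s : S} (f : X → R) {a : θ.Germ} (ha : a ∉ germSet s Set.univ) :
    germFun s f a = 0 :=
  Set.indicator_of_notMem ha _

theorem germFun_eq_of_natLE {r s : S} (h : r ≼ s) {f : X → R}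
    (hf : Function.support f ⊆ θ.dom r) : (germFun r f : θ.Germ → R) = germFun s f := by
  funext a
  by_cases ha : a ∈ germSet r Set.univ
  · rw [germFun_of_mem f ha, germFun_of_mem f (germSet_subset_of_natLE h ha)]
  · rw [germFun_of_notMem f ha]
    by_cases has : a ∈ germSet s Set.univ
    · rw [germFun_of_mem f has]
      by_contra hne
      exact ha (mem_germSet_of_natLE h has (hf (Ne.symm hne)))
    · rw [germFun_of_notMem f has]

theorem germFun_ind [T2Space X] (s : S) {K L : CompactOpens X}
    (h : ∀ x : θ.dom s⁻¹, (θ.map s x : X) ∈ L ↔ (x : X) ∈ K) :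
    germFun s (ind R L).1 = (germSet (θ := θ) s (K : Set X)).indicator 1 := by
  funext a
  by_cases ha : a ∈ germSet s Set.univ
  · rw [germFun_of_mem _ ha]
    obtain ⟨x, hx, -, rfl⟩ := ha
    by_cases hxK : x ∈ K
    · rw [Set.indicator_of_mem (germ_mem_germSet hx hxK)]
      exact ind_of_mem ((h ⟨x, hx⟩).2 hxK)
    · rw [Set.indicator_of_notMem]
      · exact ind_of_notMem fun h' => hxK ((h ⟨x, hx⟩).1 h')
      · rintro ⟨y, hy, hyK, e⟩
        exact hxK ((germ_eq_germ.1 e).1 ▸ hyK)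
  · rw [germFun_of_notMem _ ha, Set.indicator_of_notMem]
    rintro ⟨y, hy, hyK, rfl⟩
    exact ha (germ_mem_germSet _ trivial)

theorem rng_inv_mul (a c : θ.Germ) (h : src (Germ.inv a) = rng c) :
    rng (Germ.mul (Germ.inv a) c h) = src a :=
  (θ.germGroupoid.rng_mul _ c h).trans (θ.germGroupoid.rng_inv a)

/-- Since `s* s t ≤ t`, left translation by the germ of `s` carries germs of `t` to germs of `s t`,
and conversely. -/
theorem inv_germTo_mul_mem_germSet_iff {s t : S} {c : θ.Germ} (hc : rng c ∈ θ.dom s)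
    (h : src (Germ.inv (θ.germTo s (rng c) hc)) = rng c) :
    Germ.mul (Germ.inv (θ.germTo s (rng c) hc)) c h ∈ germSet t Set.univ ↔
      c ∈ germSet (s * t) Set.univ := by
  constructor
  · rintro ⟨w, hw, -, e⟩
    have h2 := (rng_inv_mul (θ.germTo s (rng c) hc) c h).symm
    have h3 : Germ.mul _ _ h2 = c := θ.germGroupoid.mul_inv_cancel (θ.germTo s (rng c) hc) c h h2
    rw [← h3, mul_eq h2 rfl e (h2.trans (congrArg rng e))]
    exact germ_mem_germSet _ trivial
  · rintro ⟨w, hw, -, e⟩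
    rw [mul_eq h (inv_germ _ _ _) e (h.trans (congrArg rng e))]
    refine germSet_subset_of_natLE ?_ (germ_mem_germSet _ trivial)
    rw [← mul_assoc]
    exact idem_mul_natLE t (inv_mul_idem s)

/-- Convolution realizes the product of monomials: if `k (θ_s y) = f (θ_s y) g y`, as is the case for
`k = α_s (α_{s*} (f) g)`, then `(f δ_s) (g δ_t)` corresponds to `k δ_{st}`. -/
theorem convolution_germFun (s t : S) (f g k : X → R)
    (hk : ∀ y : θ.dom s⁻¹, k (θ.map s y) = f (θ.map s y) * g y)
    (hk0 : Function.support k ⊆ θ.dom s) :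
    θ.germGroupoid.convolution (germFun s f) (germFun t g) = germFun (s * t) k := by
  funext c
  by_cases hc : rng c ∈ θ.dom s
  · have hr : θ.germGroupoid.rng (θ.germTo s (rng c) hc) = θ.germGroupoid.rng c :=
      rng_germTo _ _ _
    unfold TopologicalGroupoid.convolution
    rw [finsum_eq_single _ ⟨θ.germTo s (rng c) hc, hr⟩]
    · rw [germFun_of_mem _ (germTo_mem _ _ _)]
      have h : src (Germ.inv (θ.germTo s (rng c) hc)) = rng c :=
        (θ.germGroupoid.src_inv _).trans hr
      change _ * germFun t g (Germ.mul (Germ.inv (θ.germTo s (rng c) hc)) c h) = _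
      have hi := inv_germTo_mul_mem_germSet_iff (t := t) hc h
      by_cases hst : c ∈ germSet (s * t) Set.univ
      · have hk' := hk ((θ.map s).symm ⟨rng c, hc⟩)
        rw [Homeomorph.apply_symm_apply] at hk'
        rw [germFun_of_mem g (hi.2 hst), germFun_of_mem _ hst, rng_inv_mul, hk', rng_germTo]
        rfl
      · rw [germFun_of_notMem g fun h => hst (hi.1 h), germFun_of_notMem _ hst, mul_zero]
    · rintro ⟨a, ha⟩ hne
      rw [germFun_of_notMem f, zero_mul]
      intro has
      exact hne (Subtype.ext (eq_of_rng_eq has (germTo_mem _ _ _) (ha.trans hr.symm)))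
  · have h0 : k (rng c) = 0 := Function.notMem_support.1 fun h => hc (hk0 h)
    have : germFun (s * t) k c = 0 := by
      by_cases h : c ∈ germSet (s * t) Set.univ
      · rw [germFun_of_mem _ h, h0]
      · rw [germFun_of_notMem _ h]
    rw [this]
    refine finsum_eq_zero_of_forall_eq_zero fun ⟨a, ha⟩ => ?_
    rw [germFun_of_notMem f, zero_mul]
    intro has
    exact hc ((show rng a = rng c from ha) ▸ rng_mem_dom has)

theorem germFun_mem_steinbergSubmodule [LocallyCompactSpace X] [T2Space X]
    [IsZeroDimensional X] (s : S) (f : SpaceAlgebra R X)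
    (hf : Function.support f.1 ⊆ θ.dom s) :
    germFun s f.1 ∈ θ.germGroupoid.steinbergSubmodule R := by
  refine induction_ind (θ.dom s) (θ.isOpen_dom s)
    (p := fun f => germFun s f.1 ∈ θ.germGroupoid.steinbergSubmodule R) ?_ ?_ ?_ f hf
  · change germFun s 0 ∈ _
    rw [map_zero]; exact zero_mem _
  · intro f g hf hg
    change germFun s (f.1 + g.1) ∈ _
    rw [map_add]; exact add_mem hf hg
  · intro c L hL
    obtain ⟨K, hK, h⟩ := (θ.map s).symm.exists_compactOpens (θ.isOpen_dom _) hL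
    change germFun s (c • (ind R L).1) ∈ _
    rw [map_smul, germFun_ind s (K := K) fun x => by rw [← h, Homeomorph.symm_apply_apply]]
    exact Submodule.smul_mem _ c
      (Submodule.subset_span ⟨_, isCompactOpenBisection_germSet s K hK, rfl⟩)

/-- Two elements of `S` with a common germ have a common lower bound with that germ. -/
theorem exists_natLE_of_mem_germSet {s t : S} {a : θ.Germ} (hs : a ∈ germSet s Set.univ)
    (ht : a ∈ germSet t Set.univ) : ∃ u, u ≼ s ∧ u ≼ t ∧ a ∈ germSet u Set.univ := by
  obtain ⟨x, hx, -, rfl⟩ := hs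
  obtain ⟨y, hy, -, e⟩ := ht
  obtain ⟨-, u, hus, hut, hu⟩ := germ_eq_germ.1 e
  exact ⟨u, hus, hut, x, hu, trivial, (germ_eq_of_natLE hus hu).symm⟩

end TopPartialAction

/-! ### The homomorphism from the crossed product to the Steinberg algebra -/

namespace AlgPartialAction

open SpaceAlgebra TopPartialAction TopPartialAction.Germ

section

variable {S R A : Type*} [InverseSemigroup S] [CommRing R] [NonUnitalRing A]
  [Module R A] [IsScalarTower R A A] [SMulCommClass R A A] (α : AlgPartialAction S R A)

/-- The linear map on formal sums given by a linear map on each summand. -/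
noncomputable def liftFormalSum {M : Type*} [AddCommMonoid M] [Module R M]
    (F : ∀ s, α.ideal s →ₗ[R] M) : α.FormalSum →ₗ[R] M :=
  letI := Classical.decEq S
  DirectSum.toModule R S M F

@[simp] theorem liftFormalSum_delta {M : Type*} [AddCommMonoid M] [Module R M]
    (F : ∀ s, α.ideal s →ₗ[R] M) (s : S) (a : α.ideal s) :
    α.liftFormalSum F (α.delta s a) = F s a := by
  classical
  simp only [liftFormalSum, delta]
  exact DirectSum.toModule_lof ..

/-- The multiplier `a δ_s ↦ (f a) δ_s` of the formal sums. -/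
noncomputable def localize (f : A) : α.FormalSum →ₗ[R] α.FormalSum :=
  α.liftFormalSum fun s =>
    α.delta s ∘ₗ (LinearMap.mulLeft R f).restrict fun _ ha => α.mul_mem_left s f ha

theorem localize_delta (f : A) (s : S) (a : α.ideal s) :
    α.localize f (α.delta s a) = α.delta s ⟨f * a, α.mul_mem_left s f a.2⟩ :=
  α.liftFormalSum_delta _ _ _

theorem localize_zero (ξ : α.FormalSum) : α.localize 0 ξ = 0 := by
  induction ξ using α.formalSum_induction with
  | h0 => exact map_zero _
  | hd s a =>
    rw [localize_delta, ← map_zero (α.delta s)]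
    exact congrArg _ (Subtype.ext (zero_mul _))
  | ha x y hx hy => rw [map_add, hx, hy, add_zero]

theorem localize_add (f g : A) (ξ : α.FormalSum) :
    α.localize (f + g) ξ = α.localize f ξ + α.localize g ξ := by
  induction ξ using α.formalSum_induction with
  | h0 => simp only [map_zero, add_zero]
  | hd s a =>
    simp only [localize_delta]
    rw [← map_add]
    exact congrArg _ (Subtype.ext (add_mul _ _ _))
  | ha x y hx hy => simp only [map_add, hx, hy]; abel

theorem localize_mul (f g : A) (ξ : α.FormalSum) :
    α.localize (f * g) ξ = α.localize f (α.localize g ξ) := by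
  induction ξ using α.formalSum_induction with
  | h0 => simp only [map_zero]
  | hd s a =>
    simp only [localize_delta]
    exact congrArg _ (Subtype.ext (mul_assoc _ _ _))
  | ha x y hx hy => simp only [map_add, hx, hy]

theorem localize_mem_null (f : A) {ξ : α.FormalSum} (hξ : ξ ∈ α.null) :
    α.localize f ξ ∈ α.null := by
  refine AddSubgroup.closure_induction (p := fun ξ _ => α.localize f ξ ∈ α.null)
    ?_ ?_ ?_ ?_ hξ
  · rintro _ ⟨r, s, h, a, rfl⟩
    rw [map_sub, localize_delta, localize_delta]
    exact α.delta_sub_mem h _ _ rfl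
  · rw [map_zero]; exact zero_mem _
  · intro x y _ _ hx hy; rw [map_add]; exact add_mem hx hy
  · intro x _ hx; rw [map_neg]; exact neg_mem hx

theorem toCrossed_surjective : Function.Surjective α.toCrossed :=
  α.null.mkQ_surjective

theorem toCrossed_eq_zero {ξ : α.FormalSum} (h : ξ ∈ α.null) : α.toCrossed ξ = 0 :=
  (Submodule.Quotient.mk_eq_zero _).2 h

end

variable {S X R : Type*} [InverseSemigroup S] [TopologicalSpace X] [CommRing R]
  {α : AlgPartialAction S R (SpaceAlgebra R X)} {θ : TopPartialAction S X}

variable (X R) in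
/-- The inclusion of `A_R(X)` into the functions on `X`. -/
def coeLinearMap : SpaceAlgebra R X →ₗ[R] (X → R) where
  toFun f := f.1
  map_add' _ _ := rfl
  map_smul' _ _ := rfl

variable (α θ) in
/-- The map that sends `a δ_s` to the function on germs with value `a (r γ)` at the germs `γ` of
`s`. -/
noncomputable def germMap : α.FormalSum →ₗ[R] (θ.Germ → R) :=
  α.liftFormalSum fun s => germFun s ∘ₗ coeLinearMap X R ∘ₗ (α.ideal s).subtype

theorem germMap_delta (s : S) (a : α.ideal s) : α.germMap θ (α.delta s a) = germFun s a.1.1 :=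
  α.liftFormalSum_delta _ _ _

theorem germMap_eq_zero_of_mem_null (hθ : α.IsDual θ) {ξ : α.FormalSum} (hξ : ξ ∈ α.null) :
    α.germMap θ ξ = 0 := by
  refine AddSubgroup.closure_induction (p := fun ξ _ => α.germMap θ ξ = 0) ?_ ?_ ?_ ?_ hξ
  · rintro _ ⟨r, s, h, a, rfl⟩
    rw [map_sub, germMap_delta, germMap_delta, sub_eq_zero]
    exact germFun_eq_of_natLE h ((hθ.mem_ideal r a).1 a.2)
  · exact map_zero _
  · intro x y _ _ hx hy; rw [map_add, hx, hy, add_zero]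
  · intro x _ hx; rw [map_neg, hx, neg_zero]

theorem IsDual.map_apply_map (hθ : α.IsDual θ) (s : S) (f : α.ideal s⁻¹) (y : θ.dom s⁻¹) :
    (α.map s f).1.1 (θ.map s y) = f.1.1 y := by
  rw [hθ.map_apply s f _ (θ.map_mem s y), θ.map_inv_map]

theorem IsDual.coeff_apply (hθ : α.IsDual θ) {s t : S} (a : α.ideal s) (b : α.ideal t)
    (y : θ.dom s⁻¹) : (α.coeff s t a b).1 (θ.map s y) = a.1.1 (θ.map s y) * b.1.1 y := by
  have h := hθ.map_apply_map s⁻¹ ⟨a, by rw [inv_ideal_eq]; exact a.2⟩ ⟨_, θ.map_mem s y⟩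
  rw [θ.map_inv_map] at h
  exact (hθ.map_apply_map s _ y).trans (congrArg (· * b.1.1 y) h)

section

variable [LocallyCompactSpace X] [T2Space X] [IsZeroDimensional X]

theorem germMap_mem_steinbergSubmodule (hθ : α.IsDual θ) (ξ : α.FormalSum) :
    α.germMap θ ξ ∈ θ.germGroupoid.steinbergSubmodule R := by
  induction ξ using α.formalSum_induction with
  | h0 => rw [map_zero]; exact zero_mem _
  | hd s a =>
    rw [germMap_delta]
    exact germFun_mem_steinbergSubmodule s a.1 ((hθ.mem_ideal s a).1 a.2)
  | ha x y hx hy => rw [map_add]; exact add_mem hx hy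

open TopologicalGroupoid in
theorem germMap_formalMul (hθ : α.IsDual θ) (ξ η : α.FormalSum) :
    α.germMap θ (α.formalMul ξ η) =
      θ.germGroupoid.convolution (α.germMap θ ξ) (α.germMap θ η) := by
  have hm := germMap_mem_steinbergSubmodule hθ
  induction ξ using α.formalSum_induction with
  | h0 => rw [LinearMap.map_zero₂, map_zero, convolution_zero_left]
  | ha x y hx hy =>
    rw [LinearMap.map_add₂, map_add, map_add, convolution_add_left (hm x) (hm y), hx, hy]
  | hd s a =>
    induction η using α.formalSum_induction with
    | h0 => rw [map_zero, map_zero, convolution_zero_right]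
    | ha x y hx hy => rw [map_add, map_add, map_add, convolution_add_right (hm _), hx, hy]
    | hd t b =>
      rw [formalMul_delta, germMap_delta, germMap_delta, germMap_delta]
      refine (convolution_germFun s t _ _ _ (hθ.coeff_apply a b) ?_).symm
      exact (hθ.mem_ideal s _).1 (α.map s _).2

/-- Every function in the Steinberg algebra comes from a formal sum: a compact-open bisection is a
finite union of basic sets `[s, C]`, and this union can be made disjoint because the source map is
injective on the bisection. -/
theorem steinbergSubmodule_le_range (hθ : α.IsDual θ) :
    θ.germGroupoid.steinbergSubmodule R ≤ LinearMap.range (α.germMap θ) := by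
  refine Submodule.span_le.2 ?_
  rintro _ ⟨U, hU, rfl⟩
  obtain ⟨C, hC, H⟩ : ∃ C : CompactOpens X, src '' U ⊆ C ∧
      ∀ L ≤ C, (U ∩ src ⁻¹' (L : Set X)).indicator 1 ∈ LinearMap.range (α.germMap θ) := by
    refine hU.isCompact.induction_on (p := fun B => ∃ C : CompactOpens X, src '' B ⊆ C ∧
      ∀ L ≤ C, (U ∩ src ⁻¹' (L : Set X)).indicator 1 ∈ LinearMap.range (α.germMap θ)) ?_ ?_ ?_ ?_
    · refine ⟨⊥, by simp, fun L hL => ?_⟩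
      rw [le_bot_iff.1 hL, CompactOpens.coe_bot, Set.preimage_empty, Set.inter_empty,
        Set.indicator_empty']
      exact zero_mem _
    · rintro B B' hB ⟨C, hC, h⟩
      exact ⟨C, (Set.image_mono hB).trans hC, h⟩
    · rintro B B' ⟨C, hC, h⟩ ⟨C', hC', h'⟩
      refine ⟨C ⊔ C', ?_, fun L hL => ?_⟩
      · rw [Set.image_union]; exact Set.union_subset_union hC hC'
      · have e : U ∩ src ⁻¹' (L : Set X) = (U ∩ src ⁻¹' ((L ⊓ C : CompactOpens X) : Set X)) ∪
            (U ∩ src ⁻¹' ((L \ C : CompactOpens X) : Set X)) := by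
          rw [← Set.inter_union_distrib_left, ← Set.preimage_union, CompactOpens.coe_inf,
            CompactOpens.coe_sdiff, Set.inter_union_sdiff]
        have hd : Disjoint (U ∩ src ⁻¹' ((L ⊓ C : CompactOpens X) : Set X))
            (U ∩ src ⁻¹' ((L \ C : CompactOpens X) : Set X)) :=
          Set.disjoint_left.2 fun a h1 h2 => h2.2.2 h1.2.2
        rw [e, Set.indicator_union_of_disjoint hd]
        refine add_mem (h _ inf_le_right) (h' _ ?_)
        rintro x ⟨hx, hxC⟩
        exact (hL hx).resolve_left hxC
    · intro a ha
      obtain ⟨_, ⟨s, W, hW, hWs, rfl⟩, ⟨x, hx, hxW, rfl⟩, hWU⟩ :=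
        isTopologicalBasis_germSet.exists_subset_of_mem_open ha hU.isOpen
      obtain ⟨C, hxC, hCW⟩ := hW.exists_compactOpens_mem_subset hxW
      refine ⟨src ⁻¹' (C : Set X), mem_nhdsWithin_of_mem_nhds
        ((C.isOpen.preimage continuous_src).mem_nhds hxC), C, Set.image_preimage_subset _ _,
        fun L hL => ?_⟩
      have hLW : (L : Set X) ⊆ W := Set.Subset.trans hL hCW
      obtain ⟨K, hK, h⟩ := (θ.map s).exists_compactOpens (θ.isOpen_dom s) (hLW.trans hWs)
      refine ⟨α.delta s ⟨ind R K, ind_mem (hθ.mem_ideal s) hK⟩, ?_⟩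
      rw [germMap_delta, germFun_ind s h]
      congr 1
      ext b
      constructor
      · rintro ⟨y, hy, hyL, rfl⟩
        exact ⟨hWU (germ_mem_germSet hy (hLW hyL)), hyL⟩
      · rintro ⟨hb, hbL⟩
        have hy := hWs (hLW hbL)
        rw [hU.injOn_src hb (hWU (germ_mem_germSet hy (hLW hbL))) rfl]
        exact germ_mem_germSet hy hbL
  have h := H C le_rfl
  rwa [Set.inter_eq_left.2 (Set.image_subset_iff.1 hC)] at h

end

/-! ### Injectivity -/

/-- The germs at which a formal sum lives over the range point `x`, with their coefficients. -/
noncomputable def fibreMap (α : AlgPartialAction S R (SpaceAlgebra R X)) (θ : TopPartialAction S X)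
    (x : X) : α.FormalSum →ₗ[R] (θ.Germ →₀ R) :=
  open Classical in
  α.liftFormalSum fun s =>
    if h : x ∈ θ.dom s then
      Finsupp.lsingle (θ.germTo s x h) ∘ₗ LinearMap.proj x ∘ₗ coeLinearMap X R ∘ₗ
        (α.ideal s).subtype
    else 0

theorem fibreMap_delta_of_mem {x : X} {s : S} (h : x ∈ θ.dom s) (a : α.ideal s) :
    α.fibreMap θ x (α.delta s a) = Finsupp.single (θ.germTo s x h) (a.1.1 x) := by
  rw [fibreMap, liftFormalSum_delta, dif_pos h]
  rfl

theorem fibreMap_delta_of_notMem {x : X} {s : S} (h : x ∉ θ.dom s) (a : α.ideal s) :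
    α.fibreMap θ x (α.delta s a) = 0 := by
  rw [fibreMap, liftFormalSum_delta, dif_neg h]
  rfl

theorem fibreMap_eq_zero {ξ : α.FormalSum} (hξ : α.germMap θ ξ = 0) (x : X) :
    α.fibreMap θ x ξ = 0 := by
  classical
  have key : ∀ (ξ : α.FormalSum) (γ : θ.Germ),
      α.fibreMap θ x ξ γ = if rng γ = x then α.germMap θ ξ γ else 0 := by
    intro ξ γ
    induction ξ using α.formalSum_induction with
    | h0 => simp
    | ha ξ η h h' => rw [map_add, map_add, Finsupp.add_apply, h, h']; split_ifs <;> simp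
    | hd s a =>
      rw [germMap_delta]
      by_cases hx : x ∈ θ.dom s
      · rw [fibreMap_delta_of_mem hx]
        by_cases hγ : θ.germTo s x hx = γ
        · subst hγ
          rw [Finsupp.single_eq_same, if_pos (rng_germTo _ _ _),
            germFun_of_mem _ (germTo_mem _ _ _), rng_germTo]
        · rw [Finsupp.single_eq_of_ne' hγ]
          split_ifs with h
          · rw [germFun_of_notMem]
            intro hs
            exact hγ (eq_of_rng_eq (germTo_mem _ _ _) hs ((rng_germTo _ _ _).trans h.symm))
          · rfl
      · rw [fibreMap_delta_of_notMem hx, Finsupp.zero_apply]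
        split_ifs with h
        · rw [germFun_of_notMem]
          intro hs
          exact hx (h ▸ rng_mem_dom hs)
        · rfl
  ext γ
  rw [key, hξ]
  simp

theorem exists_forall_localize_eq_self [T2Space X] (ξ : α.FormalSum) :
    ∃ E : CompactOpens X, ∀ K, E ≤ K → α.localize (ind R K) ξ = ξ := by
  induction ξ using α.formalSum_induction with
  | h0 => exact ⟨⊥, fun K _ => map_zero _⟩
  | hd s a =>
    refine ⟨supp a.1, fun K hK => ?_⟩
    rw [localize_delta]
    exact congrArg _ (Subtype.ext (ind_mul_of_support_subset hK))
  | ha ξ η h h' =>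
    obtain ⟨E, h⟩ := h
    obtain ⟨E', h'⟩ := h'
    exact ⟨E ⊔ E', fun K hK => by
      rw [map_add, h K (le_sup_left.trans hK), h' K (le_sup_right.trans hK)]⟩

variable [LocallyCompactSpace X] [T2Space X] [IsZeroDimensional X]

/-- Modulo the null ideal and near the range point `x`, a formal sum depends only on its
coefficients at the finitely many germs with range `x` at which it lives: if `s` and `t` have the
same germ at `x`, then `1_K δ_s` and `1_K δ_t` agree with `1_K δ_u` for a common lower bound `u` and
all small neighbourhoods `K` of `x`. -/
theorem exists_localize_sub_mem_null (hθ : α.IsDual θ) (x : X) :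
    ∃ σ : (θ.Germ →₀ R) →ₗ[R] α.FormalSum, ∀ ξ : α.FormalSum, ∃ K : CompactOpens X, x ∈ K ∧
      α.localize (ind R K) (ξ - σ (α.fibreMap θ x ξ)) ∈ α.null := by
  have hrep : ∀ γ : θ.Germ, ∃ (s : S) (K : CompactOpens X), γ ∈ germSet s Set.univ ∧
      rng γ ∈ K ∧ (K : Set X) ⊆ θ.dom s := by
    intro γ
    obtain ⟨s, y, hy, rfl⟩ := exists_germ γ
    have hγ := germ_mem_germSet hy (Set.mem_univ y)
    obtain ⟨K, h, h'⟩ := (θ.isOpen_dom s).exists_compactOpens_mem_subset (rng_mem_dom hγ)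
    exact ⟨s, K, hγ, h, h'⟩
  choose t N hγ hN hNt using hrep
  refine ⟨Finsupp.linearCombination R fun γ =>
    α.delta (t γ) ⟨ind R (N γ), ind_mem (hθ.mem_ideal _) (hNt γ)⟩, fun ξ => ?_⟩
  induction ξ using α.formalSum_induction with
  | h0 =>
    obtain ⟨K, hK, -⟩ := isOpen_univ.exists_compactOpens_mem_subset (Set.mem_univ x)
    refine ⟨K, hK, ?_⟩
    simp only [map_zero, sub_zero]
    exact zero_mem _
  | ha ξ η h h' =>
    obtain ⟨K, hK, h⟩ := h
    obtain ⟨L, hL, h'⟩ := h'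
    refine ⟨K ⊓ L, ⟨hK, hL⟩, ?_⟩
    rw [map_add, map_add, add_sub_add_comm, map_add]
    refine add_mem ?_ ?_
    · rw [inf_comm, ind_inf, localize_mul]; exact α.localize_mem_null _ h
    · rw [ind_inf, localize_mul]; exact α.localize_mem_null _ h'
  | hd s a =>
    by_cases hx : x ∈ θ.dom s
    · rw [fibreMap_delta_of_mem hx, Finsupp.linearCombination_single]
      set γ := θ.germTo s x hx
      have hγx : rng γ = x := rng_germTo _ _ _
      obtain ⟨u, hus, hut, hu⟩ := exists_natLE_of_mem_germSet (germTo_mem s x hx) (hγ γ)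
      have hxu : x ∈ θ.dom u := hγx ▸ rng_mem_dom hu
      obtain ⟨K, hxK, hKO, hK⟩ := exists_ind_mul_eq_smul a.1
        ((θ.isOpen_dom u).inter (N γ).isOpen) ⟨hxu, (hγx ▸ hN γ : x ∈ N γ)⟩
      have hKu : ind R K ∈ α.ideal u := ind_mem (hθ.mem_ideal u) fun z hz => (hKO hz).1
      refine ⟨K, hxK, ?_⟩
      have e1 : α.localize (ind R K) (α.delta s a) =
          a.1.1 x • α.delta s ⟨ind R K, α.ideal_mono hus hKu⟩ := by
        rw [localize_delta, ← map_smul]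
        exact congrArg _ (Subtype.ext (hK K le_rfl))
      have e2 : α.localize (ind R K)
          (α.delta (t γ) ⟨ind R (N γ), ind_mem (hθ.mem_ideal _) (hNt γ)⟩) =
            α.delta (t γ) ⟨ind R K, α.ideal_mono hut hKu⟩ := by
        rw [localize_delta]
        exact congrArg _ (Subtype.ext (ind_mul_ind_of_le fun z hz => (hKO hz).2))
      have h := sub_mem
        (α.delta_sub_mem hut ⟨ind R K, hKu⟩ ⟨ind R K, α.ideal_mono hut hKu⟩ rfl)
        (α.delta_sub_mem hus ⟨ind R K, hKu⟩ ⟨ind R K, α.ideal_mono hus hKu⟩ rfl)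
      rw [sub_sub_sub_cancel_left] at h
      have h' := α.null.smul_mem (a.1.1 x) h
      rw [smul_sub] at h'
      rwa [map_sub, map_smul, e1, e2]
    · rw [fibreMap_delta_of_notMem hx, map_zero, sub_zero]
      obtain ⟨K, hxK, -, hK⟩ := exists_ind_mul_eq_smul a.1 isOpen_univ (Set.mem_univ x)
      refine ⟨K, hxK, ?_⟩
      have h0 : a.1.1 x = 0 := Function.notMem_support.1 fun h => hx ((hθ.mem_ideal s a).1 a.2 h)
      have e : (⟨ind R K * a, α.mul_mem_left s _ a.2⟩ : α.ideal s) = 0 :=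
        Subtype.ext ((hK K le_rfl).trans (by rw [h0, zero_smul]; rfl))
      rw [localize_delta, e, map_zero]
      exact zero_mem _

/-- A formal sum that vanishes as a function on germs is null near every point, hence null. -/
theorem mem_null_of_germMap_eq_zero (hθ : α.IsDual θ) {ξ : α.FormalSum}
    (hξ : α.germMap θ ξ = 0) : ξ ∈ α.null := by
  obtain ⟨E, hE⟩ := exists_forall_localize_eq_self ξ
  obtain ⟨C, hEC, hC⟩ : ∃ C : CompactOpens X, (E : Set X) ⊆ C ∧
      α.localize (ind R C) ξ ∈ α.null := by
    refine E.isCompact.induction_on (p := fun B => ∃ C : CompactOpens X, B ⊆ C ∧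
      α.localize (ind R C) ξ ∈ α.null) ?_ ?_ ?_ ?_
    · refine ⟨⊥, le_rfl, ?_⟩
      rw [ind_bot, localize_zero]
      exact zero_mem _
    · rintro B B' hB ⟨C, hC, h⟩
      exact ⟨C, hB.trans hC, h⟩
    · rintro B B' ⟨C, hC, h⟩ ⟨C', hC', h'⟩
      refine ⟨C ⊔ C', Set.union_subset_union hC hC', ?_⟩
      have e : ind R (C ⊔ C') = ind R (C' \ C) * ind R C' + ind R C := by
        rw [← ind_inf, inf_eq_left.2 sdiff_le, ind_sdiff, ind_sup, mul_comm (ind R C')]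
        abel
      rw [e, localize_add, localize_mul]
      exact add_mem (α.localize_mem_null _ h') h
    · intro x _
      obtain ⟨σ, hσ⟩ := exists_localize_sub_mem_null hθ x
      obtain ⟨K, hxK, h⟩ := hσ ξ
      rw [fibreMap_eq_zero hξ, map_zero, sub_zero] at h
      exact ⟨K, mem_nhdsWithin_of_mem_nhds (K.isOpen.mem_nhds hxK), K, le_rfl, h⟩
  rwa [hE C hEC] at hC

/-! ### The isomorphism -/

/-- `germMap`, with values in the Steinberg algebra. -/
noncomputable def steinbergMap (hθ : α.IsDual θ) :
    α.FormalSum →ₗ[R] θ.germGroupoid.SteinbergAlgebra R where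
  toFun ξ := ⟨α.germMap θ ξ, germMap_mem_steinbergSubmodule hθ ξ⟩
  map_add' ξ η := Subtype.ext ((α.germMap θ).map_add ξ η)
  map_smul' c ξ := Subtype.ext ((α.germMap θ).map_smul c ξ)

/-- The linear map from the crossed product to the Steinberg algebra induced by `germMap`. -/
noncomputable def crossedMap (hθ : α.IsDual θ) :
    α.CrossedProduct →ₗ[R] θ.germGroupoid.SteinbergAlgebra R :=
  α.null.liftQ (steinbergMap hθ) fun _ hξ => Subtype.ext (germMap_eq_zero_of_mem_null hθ hξ)

theorem crossedMap_toCrossed (hθ : α.IsDual θ) (ξ : α.FormalSum) :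
    crossedMap hθ (α.toCrossed ξ) = steinbergMap hθ ξ :=
  α.null.liftQ_apply (steinbergMap hθ) ξ

theorem steinbergMap_formalMul (hθ : α.IsDual θ) (ξ η : α.FormalSum) :
    steinbergMap hθ (α.formalMul ξ η) = steinbergMap hθ ξ * steinbergMap hθ η :=
  Subtype.ext (germMap_formalMul hθ ξ η)

theorem crossedMap_mul (hθ : α.IsDual θ) (x y : α.CrossedProduct) :
    crossedMap hθ (x * y) = crossedMap hθ x * crossedMap hθ y := by
  obtain ⟨ξ, rfl⟩ := α.toCrossed_surjective x
  obtain ⟨η, rfl⟩ := α.toCrossed_surjective y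
  rw [toCrossed_mul, crossedMap_toCrossed, crossedMap_toCrossed, crossedMap_toCrossed,
    steinbergMap_formalMul]

theorem crossedMap_injective (hθ : α.IsDual θ) : Function.Injective (crossedMap hθ) := by
  rw [injective_iff_map_eq_zero]
  intro x hx
  obtain ⟨ξ, rfl⟩ := α.toCrossed_surjective x
  rw [crossedMap_toCrossed] at hx
  exact α.toCrossed_eq_zero (mem_null_of_germMap_eq_zero hθ (congrArg Subtype.val hx))

theorem crossedMap_surjective (hθ : α.IsDual θ) : Function.Surjective (crossedMap hθ) := by
  intro f
  obtain ⟨ξ, hξ⟩ := steinbergSubmodule_le_range hθ f.2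
  exact ⟨α.toCrossed ξ, (crossedMap_toCrossed hθ ξ).trans (Subtype.ext hξ)⟩

/-- If `α` is dual to `θ`, then its crossed product is the Steinberg algebra of the groupoid of
germs of `θ`. -/
theorem IsDual.exists_bijective (hθ : α.IsDual θ) :
    ∃ Φ : α.CrossedProduct →ₙₐ[R] θ.germGroupoid.SteinbergAlgebra R, Function.Bijective Φ :=
  ⟨{ crossedMap hθ with
      map_zero' := (crossedMap hθ).map_zero
      map_mul' := crossedMap_mul hθ },
    crossedMap_injective hθ, crossedMap_surjective hθ⟩

end AlgPartialAction

theorem mainTheorem6 {S X R : Type*} [InverseSemigroup S] [Nonempty S]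
    [TopologicalSpace X] [LocallyCompactSpace X] [T2Space X] [IsZeroDimensional X]
    [CommRing R] (hR : IsIndecomposableRing R)
    (α : AlgPartialAction S R (SpaceAlgebra R X))
    (hα : ∀ s, HasLocalUnits (α.ideal s : Set (SpaceAlgebra R X))) :
    ∃ θ : TopPartialAction S X, α.IsDual θ ∧
      ∃ Φ : α.CrossedProduct →ₙₐ[R] θ.germGroupoid.SteinbergAlgebra R,
        Function.Bijective Φ := by
  obtain ⟨θ, hθ⟩ : ∃ θ : TopPartialAction S X, α.IsDual θ := by
    cases subsingleton_or_nontrivial R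
    · exact α.exists_isDual_of_subsingleton
    · exact AlgPartialAction.exists_isDual hR hα
  exact ⟨θ, hθ, hθ.exists_bijective⟩
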